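/- Let $\psi_n(x,t;\kappa)$, $n\ge 0$, be the polynomials defined by $$\sum_{n=0}^\infty \frac{\psi_n(x,t;\kappa)\,\lambda^n}{n!}=\exp\{(x+2\kappa t)\lambda+3t\lambda^2\},$$ so that, for $t\neq0$ and either choice of the square root, $$\psi_n(x,t;\kappa)=(3t)^{n/2}\,e^{-n\pi i/2}\,H_n\!\left(\frac{i(x+2\kappa t)}{2\sqrt{3t}}\right),$$ where $H_n(z)=(-1)^n e^{z^2}\frac{d^n}{dz^n}e^{-z^2}$ is the Hermite polynomial. Let $\mathcal W_x$ denote the Wronskian with respect to $x$ (equal to $1$ for the empty family), and define $$\Psi_{m,n}=\mathcal W_x(\psi_1,\psi_4,\dots,\psi_{3m+3n-5},\ \psi_2,\psi_5,\dots,\psi_{3n-4})\qquad(m,n\ge1),$$ $$\Psi_{-m,-n}=\mathcal W_x(\psi_1,\psi_4,\dots,\psi_{3m-2},\ \psi_2,\psi_5,\dots,\psi_{3m+3n-1})\qquad(m,n\ge0),$$ where each of the two runs of indices increases in steps of $3$ and may be empty. For every fixed $t$ and $\kappa$, none of these polynomials vanishes identically in $x$. Let $m,n$ be integers which are both $\ge1$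 or both $\le-1$, and let $\kappa$ be a constant. Then each of $$U^{[1]}_{m,n}=\ln\frac{\Psi_{m+1,n}}{\Psi_{m,n}}+\frac{x^2}{6t}-\tfrac13\kappa(x+\kappa t)-(2m+n)\ln t,$$ $$U^{[2]}_{m,n}=\ln\frac{\Psi_{m,n}}{\Psi_{m,n+1}}+\frac{x^2}{6t}-\tfrac13\kappa(x+\kappa t)+(m+2n)\ln t,$$ $$U^{[3]}_{m,n}=\ln\frac{\Psi_{m,n+1}}{\Psi_{m+1,n}}+\frac{x^2}{6t}-\tfrac13\kappa(x+\kappa t)+(m-n)\ln t$$ is a smooth solution of the dispersive water wave equation $$U_{tt}+2U_tU_{xx}+4U_xU_{xt}+6U_x^2U_{xx}-U_{xxxx}=0.$$ This holds for real $x,t,\kappa$ at all points where $t\ne0$ and the two polynomials $\Psi$ that occur are non-zero, with $\ln$ read as $\ln|\cdot|$; and for complex $x,t,\kappa$ on every open set of $\mathbb C^2$ on which continuous branches of the two logarithms that occur are chosen. -/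

import Mathlib

open scoped ContDiff

/-- The partial derivative of `U(x,t)` in the first variable `x`. -/
noncomputable def partialX {𝕜 : Type*} [NontriviallyNormedField 𝕜] (U : 𝕜 → 𝕜 → 𝕜) : 𝕜 → 𝕜 → 𝕜 :=
  fun x t => deriv (fun y => U y t) x

/-- The partial derivative of `U(x,t)` in the second variable `t`. -/
noncomputable def partialT {𝕜 : Type*} [NontriviallyNormedField 𝕜] (U : 𝕜 → 𝕜 → 𝕜) : 𝕜 → 𝕜 → 𝕜 :=
  fun x t => deriv (fun s => U x s) t

/-- `U` is smooth (over `ℂ`: holomorphic, when `D` is open) on `D` and satisfies the dispersive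
water wave equation
`U_tt + 2 U_t U_xx + 4 U_x U_xt + 6 U_x² U_xx - U_xxxx = 0` at every point of `D`.
It is used for open sets `D` only. -/
def IsDWWSolutionOn {𝕜 : Type*} [NontriviallyNormedField 𝕜] (D : Set (𝕜 × 𝕜))
    (U : 𝕜 → 𝕜 → 𝕜) : Prop :=
  ContDiffOn 𝕜 ∞ (fun p : 𝕜 × 𝕜 => U p.1 p.2) D ∧
    ∀ x t : 𝕜, (x, t) ∈ D →
      partialT (partialT U) x t
        + 2 * partialT U x t * partialX (partialX U) x t
        + 4 * partialX U x t * partialT (partialX U) x t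
        + 6 * partialX U x t ^ 2 * partialX (partialX U) x t
        - partialX (partialX (partialX (partialX U))) x t = 0

/-- The polynomial `ψ_n(x,t;κ)`, that is `n!` times the coefficient of `λⁿ` in
`exp((x + 2κt)λ + 3tλ²)`. The generating function identity is `hasSum_psiPoly` below. -/
noncomputable def psiPoly {𝕜 : Type*} [Field 𝕜] (κ : 𝕜) (n : ℕ) (x t : 𝕜) : 𝕜 :=
  (n.factorial : 𝕜) * ∑ k ∈ Finset.range (n / 2 + 1),
    (x + 2 * κ * t) ^ (n - 2 * k) / ((n - 2 * k).factorial : 𝕜) *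
      ((3 * t) ^ k / (k.factorial : 𝕜))

/-- The generating function of the `ψ_n`:
`∑ ψ_n(x,t;κ) λⁿ / n! = exp((x + 2κt)λ + 3tλ²)`. -/
theorem hasSum_psiPoly {𝕜 : Type*} [RCLike 𝕜] (κ x t l : 𝕜) :
    HasSum (fun n : ℕ => psiPoly κ n x t * l ^ n / (n.factorial : 𝕜))
      (NormedSpace.exp ((x + 2 * κ * t) * l + 3 * t * l ^ 2)) := by
  set u : 𝕜 := (x + 2 * κ * t) * l with hu
  set v : 𝕜 := 3 * t * l ^ 2 with hv
  let f : ℕ → 𝕜 := fun i => u ^ i / (i.factorial : 𝕜)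
  let h : ℕ → 𝕜 := fun k => v ^ k / (k.factorial : 𝕜)
  let g : ℕ → 𝕜 := Function.extend (fun k : ℕ => 2 * k) h 0
  have hinj : Function.Injective (fun k : ℕ => 2 * k) := fun a b hab => by
    simpa using hab
  have hg2 : ∀ k, g (2 * k) = h k := fun k => hinj.extend_apply h 0 k
  have hg0 : ∀ j, j ∉ Set.range (fun k : ℕ => 2 * k) → g j = 0 := fun j hj =>
    by
    have := Function.extend_apply' (f := fun k : ℕ => 2 * k) h (0 : ℕ → 𝕜) j (fun hx => hj hx)
    simpa [g] using this
  have hcomp : g ∘ (fun k : ℕ => 2 * k) = h := funext hg2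
  have hf : HasSum f (NormedSpace.exp u) := NormedSpace.expSeries_div_hasSum_exp u
  have hh : HasSum h (NormedSpace.exp v) := NormedSpace.expSeries_div_hasSum_exp v
  have hfn : Summable fun i => ‖f i‖ := NormedSpace.norm_expSeries_div_summable u
  have hhn : Summable fun i => ‖h i‖ := NormedSpace.norm_expSeries_div_summable v
  have hg : HasSum g (NormedSpace.exp v) := by
    rw [← hinj.hasSum_iff hg0, hcomp]
    exact hh
  have hgn : Summable fun i => ‖g i‖ := by
    rw [← hinj.summable_iff (fun j hj => by simp [hg0 j hj])]
    have : (fun i => ‖g i‖) ∘ (fun k : ℕ => 2 * k) = fun i => ‖h i‖ := by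
      funext k
      simp [hg2]
    rw [this]
    exact hhn
  have hs := (summable_norm_sum_mul_antidiagonal_of_summable_norm hgn hfn).of_norm.hasSum
  rw [← tsum_mul_tsum_eq_tsum_sum_antidiagonal_of_summable_norm hgn hfn, hg.tsum_eq, hf.tsum_eq,
    mul_comm, ← NormedSpace.exp_add] at hs
  suffices e : (fun n : ℕ => psiPoly κ n x t * l ^ n / (n.factorial : 𝕜)) =
      fun n => ∑ kl ∈ Finset.HasAntidiagonal.antidiagonal n, g kl.1 * f kl.2 by
    rw [e]
    exact hs
  funext n
  rw [Finset.Nat.sum_antidiagonal_eq_sum_range_succ (fun i j => g i * f j) n]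
  have himg : (Finset.range (n / 2 + 1)).image (fun k => 2 * k) ⊆ Finset.range (n + 1) := by
    intro j hj
    simp only [Finset.mem_image, Finset.mem_range] at hj ⊢
    omega
  rw [← Finset.sum_subset himg, Finset.sum_image (fun a _ b _ hab => hinj hab)]
  · have hn : (n.factorial : 𝕜) ≠ 0 := by exact_mod_cast n.factorial_ne_zero
    rw [psiPoly, mul_assoc, mul_div_cancel_left₀ _ hn, Finset.sum_mul]
    refine Finset.sum_congr rfl fun k hk => ?_
    have hk' : 2 * k ≤ n := by
      have := Finset.mem_range.1 hk
      omega
    have hl : l ^ n = l ^ (n - 2 * k) * (l ^ 2) ^ k := by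
      rw [← pow_mul, ← pow_add]
      congr 1
      omega
    rw [hg2, hl]
    simp only [f, h, hu, hv, mul_pow]
    ring
  · intro j hj hj'
    rw [hg0 j, zero_mul]
    rintro ⟨k, rfl⟩
    refine hj' (Finset.mem_image.2 ⟨k, ?_, rfl⟩)
    simp only [Finset.mem_range] at hj ⊢
    omega

/-- The Wronskian with respect to `x` of the functions `f 0, …, f (N-1)` of `(x,t)`; it is `1` for
the empty family. -/
noncomputable def wronskianX {𝕜 : Type*} [NontriviallyNormedField 𝕜] {N : ℕ}
    (f : Fin N → 𝕜 → 𝕜 → 𝕜) (x t : 𝕜) : 𝕜 :=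
  Matrix.det (Matrix.of fun i j : Fin N => iteratedDeriv (i : ℕ) (fun y => f j y t) x)

/-- `W_x(ψ_1, ψ_4, …, ψ_{3a-2}, ψ_2, ψ_5, …, ψ_{3b-1})`: first `a` functions with index `1` modulo
`3`, then `b` functions with index `2` modulo `3`. -/
noncomputable def psiWronskian {𝕜 : Type*} [NontriviallyNormedField 𝕜] (κ : 𝕜) (a b : ℕ)
    (x t : 𝕜) : 𝕜 :=
  wronskianX (Fin.append (fun i : Fin a => psiPoly κ (3 * (i : ℕ) + 1))
    (fun j : Fin b => psiPoly κ (3 * (j : ℕ) + 2))) x t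

/-- The polynomials `Ψ_{m,n}(x,t;κ)`, meant for `m, n ≥ 1` and for `m, n ≤ 0`:
* `Ψ_{m,n} = W_x(ψ_1, …, ψ_{3m+3n-5}, ψ_2, …, ψ_{3n-4})` for `m, n ≥ 1`,
* `Ψ_{-m,-n} = W_x(ψ_1, …, ψ_{3m-2}, ψ_2, …, ψ_{3m+3n-1})` for `m, n ≥ 0`.
No meaning is attached to the value at other index pairs. -/
noncomputable def PsiPoly {𝕜 : Type*} [NontriviallyNormedField 𝕜] (κ : 𝕜) (m n : ℤ)
    (x t : 𝕜) : 𝕜 :=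
  if 1 ≤ m ∧ 1 ≤ n then psiWronskian κ (m + n - 1).toNat (n - 1).toNat x t
  else psiWronskian κ (-m).toNat (-m - n).toNat x t

/-- `L` is a (continuous, hence holomorphic where `f` is) branch of `ln f` on `D`. -/
def IsLogBranchOn (D : Set (ℂ × ℂ)) (L f : ℂ → ℂ → ℂ) : Prop :=
  ContinuousOn (fun p : ℂ × ℂ => L p.1 p.2) D ∧
    ∀ x t : ℂ, (x, t) ∈ D → Complex.exp (L x t) = f x t

/-- The (physicists') Hermite polynomial
`H_n(z) = (-1)ⁿ exp(z²) dⁿ/dzⁿ exp(-z²)`. -/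
noncomputable def hermiteH (n : ℕ) (z : ℂ) : ℂ :=
  (-1) ^ n * Complex.exp (z ^ 2) * iteratedDeriv n (fun w : ℂ => Complex.exp (-w ^ 2)) z

/-! ### The polynomials `psiPoly`: recurrence, heat-type equation and Hermite equation. -/

section Psi

variable {𝕜 : Type*}

/-! Write X = x + 2κt. Each ψ_n satisfies ψ_t = 3ψ_xx + 2κψ_x and the Hermite equation 6tψ_xx + Xψ_x
= nψ, and these properties pass to Wronskians. If F is the Wronskian G with one further function ψ_m
adjoined, the Plücker relation together with the Hermite equation gives the bilinear relation
`IsDarbouxPair` between F and G (`isDarbouxPair_psiTau_cons`).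

Let W(a,b) be the Wronskian `psiWronskian κ a b`. Adjoining one index gives the steps W(a,b) →
W(a+1,b) → W(a+1,b+1). The cycle closes after a third step: adjoining ψ_0 = 1 to W(a+1,b+1) gives
the index set of W(a,b) shifted by 3 together with {0,1,2}, and since ψ_n' = nψ_{n-1} this Wronskian
is a constant times W(a,b) (`isDarbouxPair_psiWronskian_lower`). The three eigenvalues add up to
zero.

A cycle A → B → C → A of this kind is a dressing chain of period three, a symmetric form of the
fourth Painlevé equation: p = (ln B/A)_x and q = (ln C²/AB)_x have x-derivatives that are polynomial
in p and q. Weighted homogeneity of the Wronskians supplies p_t. With f = X/(6t) - p the correction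
terms in U are exactly those for which U_x = x/(2t) - f, a similarity reduction, and the wave
equation becomes a rational identity in x, t, p, q (`dwwOperator_eq_zero_of_dressing_chain`). The
three families of the theorem are the three steps of one cycle (`isDWWSolutionOn_PsiPoly`). The
chain needs C ≠ 0, which the theorem does not assume; zeros of C are finite in number on each line t
= const, so continuity covers them. -/

theorem psiPoly_zero [Field 𝕜] (κ x t : 𝕜) : psiPoly κ 0 x t = 1 := by
  simp [psiPoly]

theorem psiPoly_one [Field 𝕜] (κ x t : 𝕜) : psiPoly κ 1 x t = x + 2 * κ * t := by
  simp [psiPoly]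

/-- Padding the sum to an arbitrary length lets the sums for n, n + 1 and n + 2 be compared term by
term. -/
theorem psiPoly_eq_sum_ite [Field 𝕜] (κ : 𝕜) (n K : ℕ) (hK : n / 2 < K) (x t : 𝕜) :
    psiPoly κ n x t = (n.factorial : 𝕜) * ∑ k ∈ Finset.range K,
      if 2 * k ≤ n then (x + 2 * κ * t) ^ (n - 2 * k) / ((n - 2 * k).factorial : 𝕜) *
        ((3 * t) ^ k / (k.factorial : 𝕜)) else 0 := by
  rw [psiPoly, ← Finset.sum_filter]
  congr 2
  ext k
  simp only [Finset.mem_range, Finset.mem_filter]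
  omega

/-- Comparison of coefficients in ∂_λ exp(Xλ + 3tλ²) = (X + 6tλ) exp(Xλ + 3tλ²). -/
theorem psiPoly_add_two [Field 𝕜] [CharZero 𝕜] (κ : 𝕜) (n : ℕ) (x t : 𝕜) :
    psiPoly κ (n + 2) x t = (x + 2 * κ * t) * psiPoly κ (n + 1) x t
      + 6 * t * (n + 1) * psiPoly κ n x t := by
  have hf : ∀ j : ℕ, (j.factorial : 𝕜) ≠ 0 := fun j => by exact_mod_cast j.factorial_ne_zero
  rw [psiPoly_eq_sum_ite κ (n + 2) (n + 2) (by omega), psiPoly_eq_sum_ite κ (n + 1) (n + 2)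
    (by omega), psiPoly_eq_sum_ite κ n (n + 1) (by omega)]
  set X := x + 2 * κ * t
  -- The factor n + 2 splits as j + 2k: the part j lowers the exponent of X, the part 2k that of 3t.
  have key : ∀ j k : ℕ, j + 2 * k = n + 2 →
      ((n : 𝕜) + 2) * (X ^ j / (j.factorial : 𝕜) * ((3 * t) ^ k / (k.factorial : 𝕜))) =
      (j : 𝕜) * (X ^ j / (j.factorial : 𝕜)) * ((3 * t) ^ k / (k.factorial : 𝕜)) +
      2 * (X ^ j / (j.factorial : 𝕜)) * (k * ((3 * t) ^ k / (k.factorial : 𝕜))) := by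
    intro j k h
    have : (n : 𝕜) + 2 = j + 2 * k := by exact_mod_cast h.symm
    rw [this]; ring
  have hstep : ∀ (y : 𝕜) (j : ℕ), ((j + 1 : ℕ) : 𝕜) * (y ^ (j + 1) / ((j + 1).factorial : 𝕜)) =
      y * (y ^ j / (j.factorial : 𝕜)) := by
    intro y j
    have h1 : ((j + 1 : ℕ) : 𝕜) ≠ 0 := by exact_mod_cast j.succ_ne_zero
    rw [Nat.factorial_succ, Nat.cast_mul]
    field_simp [hf j]
    ring
  have main : ((n : 𝕜) + 2) * (∑ k ∈ Finset.range (n + 2),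
      if 2 * k ≤ n + 2 then X ^ (n + 2 - 2 * k) / ((n + 2 - 2 * k).factorial : 𝕜) *
        ((3 * t) ^ k / (k.factorial : 𝕜)) else 0) =
      X * (∑ k ∈ Finset.range (n + 2),
      if 2 * k ≤ n + 1 then X ^ (n + 1 - 2 * k) / ((n + 1 - 2 * k).factorial : 𝕜) *
        ((3 * t) ^ k / (k.factorial : 𝕜)) else 0) +
      6 * t * (∑ k ∈ Finset.range (n + 1),
      if 2 * k ≤ n then X ^ (n - 2 * k) / ((n - 2 * k).factorial : 𝕜) *
        ((3 * t) ^ k / (k.factorial : 𝕜)) else 0) := by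
    have e1 : ((n : 𝕜) + 2) * (∑ k ∈ Finset.range (n + 2),
      if 2 * k ≤ n + 2 then X ^ (n + 2 - 2 * k) / ((n + 2 - 2 * k).factorial : 𝕜) *
        ((3 * t) ^ k / (k.factorial : 𝕜)) else 0) =
        (∑ k ∈ Finset.range (n + 2), if 2 * k ≤ n + 2 then
          ((n + 2 - 2 * k : ℕ) : 𝕜) * (X ^ (n + 2 - 2 * k) / ((n + 2 - 2 * k).factorial : 𝕜)) *
            ((3 * t) ^ k / (k.factorial : 𝕜)) else 0) +
        (∑ k ∈ Finset.range (n + 2), if 2 * k ≤ n + 2 then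
          2 * (X ^ (n + 2 - 2 * k) / ((n + 2 - 2 * k).factorial : 𝕜)) *
            (k * ((3 * t) ^ k / (k.factorial : 𝕜))) else 0) := by
      rw [Finset.mul_sum, ← Finset.sum_add_distrib]
      refine Finset.sum_congr rfl fun k _ => ?_
      split_ifs with h
      · exact key _ _ (by omega)
      · simp
    rw [e1]
    congr 1
    · rw [Finset.mul_sum]
      refine Finset.sum_congr rfl fun k _ => ?_
      by_cases h : 2 * k ≤ n + 1
      · have : n + 2 - 2 * k = (n + 1 - 2 * k) + 1 := by omega
        rw [if_pos h, if_pos (by omega), this, hstep]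
        ring
      · rw [if_neg h]
        split_ifs with h'
        · have : n + 2 - 2 * k = 0 := by omega
          simp [this]
        · simp
    · rw [Finset.sum_range_succ', Finset.mul_sum]
      simp only [Nat.cast_zero, zero_mul, mul_zero, ite_self, add_zero]
      refine Finset.sum_congr rfl fun k _ => ?_
      by_cases h : 2 * k ≤ n
      · have : n + 2 - 2 * (k + 1) = n - 2 * k := by omega
        rw [if_pos h, if_pos (by omega), this, hstep]
        ring
      · rw [if_neg h, if_neg (by omega), mul_zero]
  have h2 : ((n + 2).factorial : 𝕜) = ((n + 1).factorial : 𝕜) * ((n : 𝕜) + 2) := by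
    rw [Nat.factorial_succ]; push_cast; ring
  have h1 : ((n + 1).factorial : 𝕜) = (n.factorial : 𝕜) * ((n : 𝕜) + 1) := by
    rw [Nat.factorial_succ]; push_cast; ring
  rw [h2, mul_assoc, main, mul_add]
  congr 1
  · ring
  · rw [h1]; ring

/-- Induction along the three term recurrence. -/
theorem two_step_induction {P : ℕ → Prop} (h0 : P 0) (h1 : P 1)
    (h : ∀ n, P n → P (n + 1) → P (n + 2)) (n : ℕ) : P n := by
  have : P n ∧ P (n + 1) := by
    induction n with
    | zero => exact ⟨h0, h1⟩
    | succ n ih => exact ⟨ih.2, h n ih.1 ih.2⟩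
  exact this.1

/-- The three term recurrence, in a form that includes `ψ_1`. -/
theorem psiPoly_succ [Field 𝕜] [CharZero 𝕜] (κ : 𝕜) (n : ℕ) (x t : 𝕜) :
    psiPoly κ (n + 1) x t = (x + 2 * κ * t) * psiPoly κ n x t
      + 6 * t * (n * psiPoly κ (n - 1) x t) := by
  cases n with
  | zero => simp [psiPoly_zero, psiPoly_one]
  | succ n =>
    rw [psiPoly_add_two, Nat.add_sub_cancel]
    push_cast
    ring

/-- Replacing λ by cλ in the generating function. This absorbs κ and is what links `psiPoly` to
Hermite polynomials. -/
theorem psiPoly_scale [Field 𝕜] [CharZero 𝕜] (κ c : 𝕜) (n : ℕ) (x t x' t' : 𝕜)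
    (hx : x' = c * (x + 2 * κ * t)) (ht : t' = c ^ 2 * t) :
    psiPoly 0 n x' t' = c ^ n * psiPoly κ n x t := by
  induction n using two_step_induction with
  | h0 => simp [psiPoly_zero]
  | h1 => simp [psiPoly_one, hx]
  | h n ih1 ih2 =>
    rw [psiPoly_add_two, psiPoly_add_two, ih1, ih2, hx, ht]
    ring

variable [NontriviallyNormedField 𝕜] [CharZero 𝕜]

theorem hasDerivAt_psiPoly_x (κ : 𝕜) (n : ℕ) (x t : 𝕜) :
    HasDerivAt (fun y => psiPoly κ n y t) (n * psiPoly κ (n - 1) x t) x := by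
  induction n using two_step_induction with
  | h0 => simpa [psiPoly_zero] using hasDerivAt_const x (1 : 𝕜)
  | h1 => simpa [psiPoly_zero, psiPoly_one] using (hasDerivAt_id x).add_const (2 * κ * t)
  | h n ih1 ih2 =>
    simp only [psiPoly_add_two]
    have h := (((hasDerivAt_id x).add_const (2 * κ * t)).mul ih2).add
      (ih1.const_mul (6 * t * (n + 1)))
    refine h.congr_deriv ?_
    simp only [Nat.add_sub_cancel, id]
    have e : n + 2 - 1 = n + 1 := by omega
    rw [e, psiPoly_succ κ n]
    push_cast
    ring

/-- On the generating function ∂_t acts as 3λ² + 2κλ, hence as 3∂_x² + 2κ∂_x. The truncated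
subtractions are harmless because the factors n and n - 1 vanish where they matter. -/
theorem hasDerivAt_psiPoly_t (κ : 𝕜) (n : ℕ) (x t : 𝕜) :
    HasDerivAt (fun s => psiPoly κ n x s)
      (3 * (n * ((n - 1 : ℕ) * psiPoly κ (n - 2) x t)) + 2 * κ * (n * psiPoly κ (n - 1) x t)) t := by
  induction n using two_step_induction with
  | h0 => simpa [psiPoly_zero] using hasDerivAt_const t (1 : 𝕜)
  | h1 =>
    simpa [psiPoly_zero, psiPoly_one] using ((hasDerivAt_id t).const_mul (2 * κ)).const_add x
  | h n ih1 ih2 =>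
    simp only [psiPoly_add_two]
    have h := ((((hasDerivAt_id t).const_mul (2 * κ)).const_add x).mul ih2).add
      ((((hasDerivAt_id t).const_mul 6).mul_const ((n : 𝕜) + 1)).mul ih1)
    refine h.congr_deriv ?_
    simp only [Nat.add_sub_cancel, id]
    have e : n + 2 - 1 = n + 1 := by omega
    have e' : n + 1 - 2 = n - 1 := by omega
    rw [e, e', psiPoly_succ κ n]
    cases n with
    | zero => simp [psiPoly_zero]; ring
    | succ n =>
      have e3 : n + 1 - 2 = n - 1 := by omega
      rw [e3, Nat.add_sub_cancel, psiPoly_succ κ n]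
      push_cast
      ring

theorem contDiff_psiPoly {𝕜 : Type*} [NontriviallyNormedField 𝕜] (κ : 𝕜) (n : ℕ) :
    ContDiff 𝕜 ∞ (fun p : 𝕜 × 𝕜 => psiPoly κ n p.1 p.2) := by
  unfold psiPoly
  fun_prop

/-- The `i`-th derivative of `ψ_n` in `x`. -/
noncomputable def psiDeriv {𝕜 : Type*} [Field 𝕜] (κ : 𝕜) (n i : ℕ) (x t : 𝕜) : 𝕜 :=
  n.descFactorial i * psiPoly κ (n - i) x t


theorem psiDeriv_succ_succ {𝕜 : Type*} [Field 𝕜] (κ : 𝕜) (n i : ℕ) (x t : 𝕜) :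
    psiDeriv κ (n + 1) (i + 1) x t = (n + 1) * psiDeriv κ n i x t := by
  simp only [psiDeriv, Nat.succ_descFactorial_succ, Nat.add_sub_add_right]
  push_cast
  ring

theorem hasDerivAt_psiDeriv_x (κ : 𝕜) (n i : ℕ) (x t : 𝕜) :
    HasDerivAt (fun y => psiDeriv κ n i y t) (psiDeriv κ n (i + 1) x t) x := by
  refine ((hasDerivAt_psiPoly_x κ (n - i) x t).const_mul _).congr_deriv ?_
  rw [psiDeriv, Nat.descFactorial_succ, Nat.sub_sub]
  push_cast
  ring

theorem hasDerivAt_psiDeriv_t (κ : 𝕜) (n i : ℕ) (x t : 𝕜) :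
    HasDerivAt (fun s => psiDeriv κ n i x s)
      (3 * psiDeriv κ n (i + 2) x t + 2 * κ * psiDeriv κ n (i + 1) x t) t := by
  refine ((hasDerivAt_psiPoly_t κ (n - i) x t).const_mul _).congr_deriv ?_
  rw [psiDeriv, psiDeriv, Nat.descFactorial_succ, Nat.descFactorial_succ, Nat.sub_sub, Nat.sub_sub]
  push_cast
  ring

/-- The Hermite equation differentiated i times; the term with factor i comes from differentiating
the coefficient x. -/
theorem psiDeriv_ode (κ : 𝕜) (n i : ℕ) (x t : 𝕜) :
    6 * t * psiDeriv κ n (i + 2) x t + (x + 2 * κ * t) * psiDeriv κ n (i + 1) x t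
      + i * psiDeriv κ n i x t = n * psiDeriv κ n i x t := by
  rcases lt_or_ge n i with h | h
  · simp [psiDeriv, Nat.descFactorial_of_lt h, Nat.descFactorial_succ]
  · obtain ⟨m, rfl⟩ := Nat.exists_eq_add_of_le h
    simp only [psiDeriv, Nat.descFactorial_succ]
    cases m with
    | zero => simp
    | succ m =>
      have e1 : i + (m + 1) - i = m + 1 := by omega
      have e2 : i + (m + 1) - (i + 1) = m := by omega
      have e3 : i + (m + 1) - (i + 2) = m - 1 := by omega
      rw [e1, e2, e3, psiPoly_succ κ m]
      push_cast
      ring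

theorem iteratedDeriv_psiPoly (κ : 𝕜) (n i : ℕ) (t : 𝕜) :
    iteratedDeriv i (fun y => psiPoly κ n y t) = fun x => psiDeriv κ n i x t := by
  induction i with
  | zero => funext x; simp [psiDeriv]
  | succ i ih =>
    rw [iteratedDeriv_succ, ih]
    funext x
    exact (hasDerivAt_psiDeriv_x κ n i x t).deriv

theorem contDiff_psiDeriv {𝕜 : Type*} [NontriviallyNormedField 𝕜] (κ : 𝕜) (n i : ℕ) :
    ContDiff 𝕜 ∞ (fun p : 𝕜 × 𝕜 => psiDeriv κ n i p.1 p.2) :=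
  contDiff_const.mul (contDiff_psiPoly κ (n - i))

end Psi

/-! ### Derivative of a determinant and a Plücker relation. -/

section Determinants

theorem det_updateRow_eq_sum_adjugate {R : Type*} [CommRing R] {ι : Type*} [Fintype ι]
    [DecidableEq ι] (A : Matrix ι ι R) (i : ι) (b : ι → R) :
    (A.updateRow i b).det = ∑ j, A.adjugate j i * b j := by
  rw [← Matrix.det_transpose, ← Matrix.updateCol_transpose, ← Matrix.cramer_apply,
    Matrix.cramer_eq_adjugate_mulVec, ← Matrix.adjugate_transpose]
  rfl

/-- Jacobi's trace `tr (adj A * B)`, once along columns and once along rows. -/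
theorem sum_det_updateCol_eq_sum_det_updateRow {R : Type*} [CommRing R] {ι : Type*} [Fintype ι]
    [DecidableEq ι] (A B : Matrix ι ι R) :
    ∑ j, (A.updateCol j (fun i => B i j)).det = ∑ i, (A.updateRow i (B i)).det := by
  have h1 : ∀ j, (A.updateCol j (fun i => B i j)).det = ∑ i, A.adjugate j i * B i j := by
    intro j
    rw [← Matrix.cramer_apply, Matrix.cramer_eq_adjugate_mulVec]
    rfl
  simp_rw [h1, det_updateRow_eq_sum_adjugate]
  exact Finset.sum_comm

theorem hasDerivAt_det {𝕜 : Type*} [NontriviallyNormedField 𝕜] {ι : Type*} [Fintype ι]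
    [DecidableEq ι] (A : 𝕜 → Matrix ι ι 𝕜) (A' : Matrix ι ι 𝕜) (x : 𝕜)
    (h : ∀ i j, HasDerivAt (fun y => A y i j) (A' i j) x) :
    HasDerivAt (fun y => (A y).det) (∑ i, ((A x).updateRow i (A' i)).det) x := by
  -- The Leibniz formula is a product over columns, so the product rule differentiates one column at
  -- a time; the trace identity converts this to rows.
  rw [← sum_det_updateCol_eq_sum_det_updateRow]
  simp only [Matrix.det_apply']
  rw [Finset.sum_comm]
  refine HasDerivAt.fun_sum fun σ _ => ?_
  rw [← Finset.mul_sum]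
  refine ((HasDerivAt.fun_finsetProd fun i _ => h (σ i) i).const_mul _).congr_deriv ?_
  congr 1
  refine Finset.sum_congr rfl fun j _ => ?_
  rw [← Finset.mul_prod_erase _ _ (Finset.mem_univ j), Matrix.updateCol_self, smul_eq_mul, mul_comm]
  congr 1
  refine Finset.prod_congr rfl fun k hk => ?_
  rw [Matrix.updateCol_ne (Finset.ne_of_mem_erase hk)]

/-- The three term Plücker relation behind the Wronskian identities: Laplace expansion of a
determinant with dependent columns. -/
theorem sum_det_succAbove_mul_eq_zero {K : Type*} [Field K] {N : ℕ}
    (v : Fin (N + 1) → Fin N → K) (c : Fin N → K) :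
    ∑ i : Fin (N + 1), (-1) ^ (i : ℕ) * (∑ j, c j * v i j) *
      (Matrix.of fun k j => v (i.succAbove k) j).det = 0 := by
  set M : Matrix (Fin (N + 1)) (Fin (N + 1)) K :=
    Matrix.of fun i => Fin.cons (∑ j, c j * v i j) (v i) with hM
  have h0 : M.det = 0 := by
    -- The first column is the combination of the others with coefficients c, so (-1, c) lies in the
    -- kernel.
    refine Matrix.exists_mulVec_eq_zero_iff.1 ⟨Fin.cons (-1) c, fun h => ?_, ?_⟩
    · have := congrFun h 0
      simp at this
    · funext i
      simp only [Matrix.mulVec, dotProduct, Fin.sum_univ_succ, hM, Matrix.of_apply, Fin.cons_zero,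
        Fin.cons_succ, Pi.zero_apply]
      simp_rw [mul_comm (v i _)]
      ring
  rw [← h0, Matrix.det_succ_column_zero]
  refine Finset.sum_congr rfl fun i _ => ?_
  rfl

end Determinants

/-! ### Determinants of derivatives of the ψ_n with arbitrary orders in the rows. -/

section PsiDet

variable {𝕜 : Type*}

/-- The determinant of the derivatives of order `r i` of the polynomials `ψ_{n j}`. -/
noncomputable def psiDet [Field 𝕜] (κ : 𝕜) {N : ℕ} (n r : Fin N → ℕ) (x t : 𝕜) : 𝕜 :=
  (Matrix.of fun i j : Fin N => psiDeriv κ (n j) (r i) x t).det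

theorem psiDet_eq_zero [Field 𝕜] (κ : 𝕜) {N : ℕ} (n r : Fin N → ℕ) (x t : 𝕜) {i j : Fin N}
    (hij : i ≠ j) (h : r i = r j) : psiDet κ n r x t = 0 :=
  Matrix.det_zero_of_row_eq hij (by funext k; simp [h])

theorem psiDet_comp_perm [Field 𝕜] (κ : 𝕜) {N : ℕ} (n r : Fin N → ℕ) (σ : Equiv.Perm (Fin N))
    (x t : 𝕜) : psiDet κ n (r ∘ σ) x t = Equiv.Perm.sign σ * psiDet κ n r x t := by
  rw [psiDet, psiDet, ← Matrix.det_permute]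
  rfl

theorem psiDet_perm_left [Field 𝕜] (κ : 𝕜) {N : ℕ} (n r : Fin N → ℕ) (σ : Equiv.Perm (Fin N))
    (x t : 𝕜) : psiDet κ (n ∘ σ) r x t = Equiv.Perm.sign σ * psiDet κ n r x t := by
  rw [psiDet, psiDet, ← Matrix.det_permute']
  rfl

theorem updateRow_psiDet [Field 𝕜] (κ : 𝕜) {N : ℕ} (n r : Fin N → ℕ) (i : Fin N) (s : ℕ)
    (x t : 𝕜) :
    ((Matrix.of fun i j : Fin N => psiDeriv κ (n j) (r i) x t).updateRow i
      (fun j => psiDeriv κ (n j) s x t)).det = psiDet κ n (Function.update r i s) x t := by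
  rw [psiDet]
  congr 1
  ext a b
  by_cases h : a = i
  · subst h; simp
  · simp [h]

variable [NontriviallyNormedField 𝕜]

theorem contDiff_psiDet (κ : 𝕜) {N : ℕ} (n r : Fin N → ℕ) :
    ContDiff 𝕜 ∞ (fun p : 𝕜 × 𝕜 => psiDet κ n r p.1 p.2) := by
  simp only [psiDet, Matrix.det_apply']
  exact ContDiff.sum fun σ _ => contDiff_const.mul (contDiff_prod fun i _ => contDiff_psiDeriv _ _ _)

variable [CharZero 𝕜]

/-- The derivative of `psiDet` in `x`. -/
noncomputable def psiDetX {𝕜 : Type*} [Field 𝕜] (κ : 𝕜) {N : ℕ} (n r : Fin N → ℕ) (x t : 𝕜) : 𝕜 :=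
  ∑ i, psiDet κ n (Function.update r i (r i + 1)) x t

/-- The sum of the determinants with one row of `psiDet` differentiated twice in `x`. -/
noncomputable def psiDetXX {𝕜 : Type*} [Field 𝕜] (κ : 𝕜) {N : ℕ} (n r : Fin N → ℕ) (x t : 𝕜) : 𝕜 :=
  ∑ i, psiDet κ n (Function.update r i (r i + 2)) x t

theorem hasDerivAt_psiDet_x (κ : 𝕜) {N : ℕ} (n r : Fin N → ℕ) (x t : 𝕜) :
    HasDerivAt (fun y => psiDet κ n r y t) (psiDetX κ n r x t) x := by
  refine (hasDerivAt_det _ (Matrix.of fun i j => psiDeriv κ (n j) (r i + 1) x t) x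
    fun i j => hasDerivAt_psiDeriv_x κ (n j) (r i) x t).congr_deriv ?_
  exact Finset.sum_congr rfl fun i _ => updateRow_psiDet κ n r i _ x t

theorem hasDerivAt_psiDet_t (κ : 𝕜) {N : ℕ} (n r : Fin N → ℕ) (x t : 𝕜) :
    HasDerivAt (fun s => psiDet κ n r x s)
      (3 * psiDetXX κ n r x t + 2 * κ * psiDetX κ n r x t) t := by
  refine (hasDerivAt_det _ (Matrix.of fun i j => 3 * psiDeriv κ (n j) (r i + 2) x t
    + 2 * κ * psiDeriv κ (n j) (r i + 1) x t) t
    fun i j => hasDerivAt_psiDeriv_t κ (n j) (r i) x t).congr_deriv ?_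
  rw [psiDetXX, psiDetX, Finset.mul_sum, Finset.mul_sum, ← Finset.sum_add_distrib]
  refine Finset.sum_congr rfl fun i _ => ?_
  rw [← updateRow_psiDet, ← updateRow_psiDet, ← Matrix.det_updateRow_smul,
    ← Matrix.det_updateRow_smul, ← Matrix.det_updateRow_add]
  rfl

/-- Applying the Hermite equation in every column. -/
theorem psiDet_ode (κ : 𝕜) {N : ℕ} (n r : Fin N → ℕ) (x t : 𝕜) :
    6 * t * psiDetXX κ n r x t + (x + 2 * κ * t) * psiDetX κ n r x t
      = ((∑ j, (n j : 𝕜)) - ∑ i, (r i : 𝕜)) * psiDet κ n r x t := by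
  set A : Matrix (Fin N) (Fin N) 𝕜 := Matrix.of fun i j => psiDeriv κ (n j) (r i) x t with hA
  have h := sum_det_updateCol_eq_sum_det_updateRow A
    (Matrix.of fun i j => (n j : 𝕜) * psiDeriv κ (n j) (r i) x t)
  have hl : ∀ j, (A.updateCol j fun i => (Matrix.of fun i j =>
      (n j : 𝕜) * psiDeriv κ (n j) (r i) x t : Matrix (Fin N) (Fin N) 𝕜) i j).det
      = n j * psiDet κ n r x t := by
    intro j
    have := Matrix.det_updateCol_smul A j (n j : 𝕜) (fun i => A i j)
    rw [Matrix.updateCol_eq_self] at this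
    exact this
  have hr : ∀ i, (A.updateRow i ((Matrix.of fun i j =>
      (n j : 𝕜) * psiDeriv κ (n j) (r i) x t : Matrix (Fin N) (Fin N) 𝕜) i)).det
      = 6 * t * psiDet κ n (Function.update r i (r i + 2)) x t
        + (x + 2 * κ * t) * psiDet κ n (Function.update r i (r i + 1)) x t
        + r i * psiDet κ n r x t := by
    intro i
    have e : psiDet κ n r x t = psiDet κ n (Function.update r i (r i)) x t := by simp
    rw [e, ← updateRow_psiDet, ← updateRow_psiDet, ← updateRow_psiDet,
      ← Matrix.det_updateRow_smul, ← Matrix.det_updateRow_smul, ← Matrix.det_updateRow_smul,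
      ← Matrix.det_updateRow_add, ← Matrix.det_updateRow_add]
    congr 2
    funext j
    simp only [Matrix.of_apply, Pi.add_apply, Pi.smul_apply, smul_eq_mul]
    exact (psiDeriv_ode κ (n j) (r i) x t).symm
  simp_rw [hl, hr] at h
  rw [Finset.sum_add_distrib, Finset.sum_add_distrib, ← Finset.mul_sum, ← Finset.mul_sum,
    ← Finset.sum_mul, ← Finset.sum_mul] at h
  rw [psiDetXX, psiDetX, sub_mul, h]
  ring

/-- Weighted homogeneity of `psiDet`. -/
theorem hasDerivAt_psiDet_t_of_ne (κ : 𝕜) {N : ℕ} (n r : Fin N → ℕ) (x t : 𝕜) (ht : t ≠ 0) :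
    HasDerivAt (fun s => psiDet κ n r x s)
      ((((∑ j, (n j : 𝕜)) - ∑ i, (r i : 𝕜)) * psiDet κ n r x t
        - (x - 2 * κ * t) * psiDetX κ n r x t) / (2 * t)) t := by
  refine (hasDerivAt_psiDet_t κ n r x t).congr_deriv ?_
  -- The drift 2κ contributes 4κt over the denominator 2t, which turns x + 2κt into x - 2κt.
  rw [← psiDet_ode]
  field_simp
  ring

end PsiDet

/-! ### Second derivatives of Wronskians and the bilinear identity. -/

section Bilinear

variable {𝕜 : Type*} [Field 𝕜] (κ : 𝕜)

/-- The rows `0, …, K - 1, K + 1` of the derivative of a Wronskian of size `K + 1`. -/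
def nextRow (K : ℕ) : Fin (K + 1) → ℕ := Function.update Fin.val (Fin.last K) (K + 1)

/-- Differentiating any row but the last duplicates the next one. -/
theorem psiDetX_val {K : ℕ} (n : Fin (K + 1) → ℕ) (x t : 𝕜) :
    psiDetX κ n Fin.val x t = psiDet κ n (nextRow K) x t := by
  rw [psiDetX, Fin.sum_univ_castSucc, Finset.sum_eq_zero, zero_add]
  · simp [nextRow]
  · intro j _
    refine psiDet_eq_zero κ n _ x t (i := j.castSucc) (j := j.succ) (Fin.castSucc_lt_succ).ne ?_
    rw [Function.update_self, Function.update_of_ne (Fin.castSucc_lt_succ).ne']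
    simp

theorem psiDet_swap {N : ℕ} (n r s : Fin N → ℕ) (x t : 𝕜) {i j : Fin N} (hij : i ≠ j)
    (h : s = r ∘ Equiv.swap i j) : psiDet κ n s x t = -psiDet κ n r x t := by
  rw [h, psiDet_comp_perm, Equiv.Perm.sign_swap hij]
  simp

/-- Let P have last row K + 2, and let Q have last two rows K, K + 1. The second x-derivative of the
Wronskian is P + Q, whereas differentiating single rows twice gives P - Q, since there the two rows
appear exchanged. For K = 0 there is no Q. The next lemma is the difference instead of the sum. -/
theorem psiDetX_nextRow_add {K : ℕ} (n : Fin (K + 1) → ℕ) (x t : 𝕜) :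
    psiDetX κ n (nextRow K) x t + psiDetXX κ n Fin.val x t =
      2 * psiDet κ n (Function.update Fin.val (Fin.last K) (K + 2)) x t := by
  rw [psiDetX, psiDetXX, ← Finset.sum_add_distrib, Fin.sum_univ_castSucc, Finset.sum_eq_zero,
    zero_add]
  · simp [nextRow]
    ring
  · intro j _
    have hj := j.isLt
    by_cases h : (j : ℕ) + 1 < K
    · have e1 : j.castSucc ≠ (⟨j + 1, by omega⟩ : Fin (K + 1)) := by
        simp [Fin.ext_iff]
      have e2 : j.castSucc ≠ (⟨j + 2, by omega⟩ : Fin (K + 1)) := by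
        simp [Fin.ext_iff]
      have e3 : (⟨j + 1, by omega⟩ : Fin (K + 1)) ≠ Fin.last K := by
        simp [Fin.ext_iff]; omega
      have e4 : j.castSucc ≠ Fin.last K := by
        simp [Fin.ext_iff]; omega
      rw [psiDet_eq_zero κ n _ x t e1, psiDet_eq_zero κ n _ x t e2, add_zero]
      · rw [Function.update_self, Function.update_of_ne e2.symm]
        simp
      · rw [Function.update_self, Function.update_of_ne e1.symm, nextRow,
          Function.update_of_ne e3, Function.update_of_ne e4]
        simp
    · have e4 : j.castSucc ≠ Fin.last K := by
        simp [Fin.ext_iff]; omega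
      rw [psiDet_swap κ n _ (Function.update Fin.val j.castSucc (j.castSucc + 2)) x t e4, ]
      · exact add_neg_cancel _
      · funext k
        by_cases hk : k = j.castSucc
        · subst hk
          simp [nextRow, Function.update_of_ne e4.symm]
          omega
        · by_cases hk' : k = Fin.last K
          · subst hk'
            simp [nextRow, Function.update_of_ne e4.symm]
            omega
          · simp [nextRow, Equiv.swap_apply_of_ne_of_ne hk hk', hk, hk']

theorem psiDetX_nextRow_sub {K : ℕ} (n : Fin (K + 2) → ℕ) (x t : 𝕜) :
    psiDetX κ n (nextRow (K + 1)) x t - psiDetXX κ n Fin.val x t =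
      2 * psiDet κ n (fun i => (Fin.succAbove (⟨K, by omega⟩ : Fin (K + 3)) i : ℕ)) x t := by
  have e4 : (Fin.last K).castSucc ≠ Fin.last (K + 1) := by simp [Fin.ext_iff]
  rw [psiDetX, psiDetXX, ← Finset.sum_sub_distrib, Fin.sum_univ_castSucc, Fin.sum_univ_castSucc,
    Finset.sum_eq_zero, zero_add]
  · have h1 : Function.update (nextRow (K + 1)) (Fin.last K).castSucc
        (nextRow (K + 1) (Fin.last K).castSucc + 1) =
        (fun i => (Fin.succAbove (⟨K, by omega⟩ : Fin (K + 3)) i : ℕ)) := by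
      funext k
      by_cases hk : k = (Fin.last K).castSucc
      · subst hk
        simp [nextRow, Fin.succAbove, Fin.lt_def]
      · by_cases hk' : k = Fin.last (K + 1)
        · subst hk'
          simp [nextRow, Fin.succAbove, Fin.lt_def, Function.update_of_ne e4.symm]
        · have : (k : ℕ) < K := by
            have := k.isLt
            simp only [Fin.ext_iff, Fin.val_castSucc, Fin.val_last] at hk hk'
            omega
          simp [nextRow, hk, hk', Fin.succAbove, Fin.lt_def, this]
    have h2 := psiDet_swap κ n (fun i => (Fin.succAbove (⟨K, by omega⟩ : Fin (K + 3)) i : ℕ))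
      (Function.update Fin.val (Fin.last K).castSucc ((Fin.last K).castSucc + 2)) x t e4 (by
        funext k
        by_cases hk : k = (Fin.last K).castSucc
        · subst hk
          simp [Fin.succAbove, Fin.lt_def]
        · by_cases hk' : k = Fin.last (K + 1)
          · subst hk'
            simp [Fin.succAbove, Fin.lt_def, Function.update_of_ne e4.symm]
          · have : (k : ℕ) < K := by
              have := k.isLt
              simp only [Fin.ext_iff, Fin.val_castSucc, Fin.val_last] at hk hk'
              omega
            simp [Equiv.swap_apply_of_ne_of_ne hk hk', hk, Fin.succAbove, Fin.lt_def, this])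
    rw [h1, h2]
    simp [nextRow]
    ring
  · intro j _
    have hj := j.isLt
    have e1 : j.castSucc.castSucc ≠ (⟨j + 1, by omega⟩ : Fin (K + 2)) := by
      simp [Fin.ext_iff]
    have e2 : j.castSucc.castSucc ≠ (⟨j + 2, by omega⟩ : Fin (K + 2)) := by
      simp [Fin.ext_iff]
    have e3 : (⟨j + 1, by omega⟩ : Fin (K + 2)) ≠ Fin.last (K + 1) := by
      simp [Fin.ext_iff]; omega
    have e5 : j.castSucc.castSucc ≠ Fin.last (K + 1) := by
      simp [Fin.ext_iff]; omega
    rw [psiDet_eq_zero κ n _ x t e1, psiDet_eq_zero κ n _ x t e2, sub_zero]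
    · rw [Function.update_self, Function.update_of_ne e2.symm]
      simp
    · rw [Function.update_self, Function.update_of_ne e1.symm, nextRow,
        Function.update_of_ne e3, Function.update_of_ne e5]
      simp

/-- In terms of G, built on n, and F, built on `Fin.cons m n`, the middle product is G_x F_x and the
outer ones are evaluated by the two preceding lemmas. -/
theorem psiDet_plucker {K : ℕ} (m : ℕ) (n : Fin (K + 1) → ℕ) (x t : 𝕜) :
    psiDet κ n Fin.val x t * psiDet κ (Fin.cons m n : Fin (K + 2) → ℕ)
        (fun i => (Fin.succAbove (⟨K, by omega⟩ : Fin (K + 3)) i : ℕ)) x t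
      - psiDet κ n (nextRow K) x t
        * psiDet κ (Fin.cons m n : Fin (K + 2) → ℕ) (nextRow (K + 1)) x t
      + psiDet κ n (Function.update Fin.val (Fin.last K) (K + 2)) x t
        * psiDet κ (Fin.cons m n : Fin (K + 2) → ℕ) Fin.val x t = 0 := by
  set A : Matrix (Fin (K + 1)) (Fin (K + 1)) 𝕜 :=
    Matrix.of fun i j => psiDeriv κ (n j) i x t with hA
  -- The cofactors of the last row of G, with 0 for the new column, make the linear combination
  -- equal to G with its last row replaced by derivatives of order i.
  have hc : ∀ i : ℕ, ∑ j, (Fin.cons 0 fun j => A.adjugate j (Fin.last K) : Fin (K + 2) → 𝕜) j *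
      psiDeriv κ ((Fin.cons m n : Fin (K + 2) → ℕ) j) i x t =
      psiDet κ n (Function.update Fin.val (Fin.last K) i) x t := by
    intro i
    rw [← updateRow_psiDet, ← hA, det_updateRow_eq_sum_adjugate, Fin.sum_univ_succ]
    simp
  have h := sum_det_succAbove_mul_eq_zero
    (fun (i : Fin (K + 3)) (j : Fin (K + 2)) =>
      psiDeriv κ ((Fin.cons m n : Fin (K + 2) → ℕ) j) i x t)
    (Fin.cons 0 fun j => A.adjugate j (Fin.last K))
  simp_rw [hc] at h
  -- For i < K the replaced row repeats an earlier one, so only i = K, K + 1, K + 2 survive.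
  rw [Fin.sum_univ_castSucc, Fin.sum_univ_castSucc, Fin.sum_univ_castSucc,
    Finset.sum_eq_zero, zero_add] at h
  · have h1 : Function.update Fin.val (Fin.last K) K = (Fin.val : Fin (K + 1) → ℕ) := by
      conv_rhs => rw [← Function.update_eq_self (Fin.last K) (Fin.val : Fin (K + 1) → ℕ)]
      rw [Fin.val_last]
    have h2 : (fun i : Fin (K + 2) => ((Fin.last (K + 2)).succAbove i : ℕ)) = Fin.val := by
      funext i; simp
    have h3 : (fun i : Fin (K + 2) => ((Fin.last (K + 1)).castSucc.succAbove i : ℕ)) =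
        nextRow (K + 1) := by
      funext k
      by_cases hk : k = Fin.last (K + 1)
      · subst hk
        simp [nextRow, Fin.succAbove]
      · have : (k : ℕ) < K + 1 := by
          have := k.isLt
          simp only [Fin.ext_iff, Fin.val_last] at hk
          omega
        simp [nextRow, hk, Fin.succAbove, Fin.lt_def, this]
    have hF : ∀ a : Fin (K + 3), (Matrix.of fun (k j : Fin (K + 2)) =>
        psiDeriv κ ((Fin.cons m n : Fin (K + 2) → ℕ) j) (a.succAbove k) x t).det =
        psiDet κ (Fin.cons m n : Fin (K + 2) → ℕ) (fun i => (a.succAbove i : ℕ)) x t :=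
      fun a => rfl
    simp only [hF, h2, h3, Fin.val_last, Fin.val_castSucc, h1] at h
    have h4 : (Fin.last K).castSucc.castSucc = (⟨K, by omega⟩ : Fin (K + 3)) := rfl
    rw [h4] at h
    have h5 : ((-1 : 𝕜) ^ K) ≠ 0 := pow_ne_zero _ (by simp)
    refine (mul_eq_zero.1 ?_).resolve_left h5
    rw [← h, nextRow]
    ring
  · intro j _
    rw [psiDet_eq_zero κ n _ x t (i := j.castSucc) (j := Fin.last K)]
    · simp
    · simp [Fin.ext_iff]; exact j.isLt.ne
    · rw [Function.update_self, Function.update_of_ne]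
      · simp
      · simp [Fin.ext_iff]; exact j.isLt.ne

end Bilinear

/-! ### Wronskians as tau functions: Darboux pairs and homogeneity. -/

section Tau

variable {𝕜 : Type*} [NontriviallyNormedField 𝕜]

/-- The bilinear form of the Darboux transformation from `G` to `F` with eigenvalue `d`. -/
def IsDarbouxPair (κ d : 𝕜) (F G : 𝕜 → 𝕜 → 𝕜) : Prop :=
  ∀ x t : 𝕜, 6 * t * (partialX (partialX F) x t * G x t - 2 * (partialX F x t * partialX G x t)
    + F x t * partialX (partialX G) x t)
    + (x + 2 * κ * t) * (partialX F x t * G x t - F x t * partialX G x t) = d * (F x t * G x t)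

/-- Infinitesimal homogeneity of weight `d` of `F` and of its `x`-derivative, for
`(x + 2κt, t) ↦ (c(x + 2κt), c²t)`. -/
def IsHomogeneousOfWeight (κ d : 𝕜) (F : 𝕜 → 𝕜 → 𝕜) : Prop :=
  ∀ x t : 𝕜, t ≠ 0 →
    HasDerivAt (fun s => F x s) ((d * F x t - (x - 2 * κ * t) * partialX F x t) / (2 * t)) t ∧
    HasDerivAt (fun s => partialX F x s)
      (((d - 1) * partialX F x t - (x - 2 * κ * t) * partialX (partialX F) x t) / (2 * t)) t

theorem partialX_const_mul (k : 𝕜) (F : 𝕜 → 𝕜 → 𝕜) :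
    partialX (fun x t => k * F x t) = fun x t => k * partialX F x t := by
  funext x t
  exact deriv_const_mul_field k

theorem IsDarbouxPair.of_const_mul {κ d k l : 𝕜} {F G : 𝕜 → 𝕜 → 𝕜} (hk : k ≠ 0) (hl : l ≠ 0)
    (h : IsDarbouxPair κ d (fun x t => k * F x t) (fun x t => l * G x t)) :
    IsDarbouxPair κ d F G := by
  intro x t
  have := h x t
  simp only [partialX_const_mul] at this
  refine mul_left_cancel₀ (mul_ne_zero hk hl) ?_
  linear_combination this

/-- The Wronskian of the polynomials `ψ_{n j}`. -/
noncomputable def psiTau (κ : 𝕜) {N : ℕ} (n : Fin N → ℕ) : 𝕜 → 𝕜 → 𝕜 := psiDet κ n Fin.val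

/-- Reordering columns costs only a sign, so up to a non-zero constant only the set of indices
matters. -/
theorem psiTau_eq_of_range_eq (κ : 𝕜) {N N' : ℕ} {n : Fin N → ℕ} {n' : Fin N' → ℕ}
    (hn : Function.Injective n) (hn' : Function.Injective n') (h : Set.range n = Set.range n') :
    ∃ k : 𝕜, k ≠ 0 ∧ psiTau κ n = fun x t => k * psiTau κ n' x t := by
  let e : Fin N ≃ Fin N' :=
    ((Equiv.ofInjective n hn).trans (Equiv.setCongr h)).trans (Equiv.ofInjective n' hn').symm
  have he : ∀ i, n' (e i) = n i := fun i => by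
    have := Equiv.apply_ofInjective_symm hn' ((Equiv.setCongr h) (Equiv.ofInjective n hn i))
    simpa [e] using this
  have hN : N = N' := Fin.equiv_iff_eq.1 ⟨e⟩
  subst hN
  refine ⟨((Equiv.Perm.sign e : ℤ) : 𝕜), ?_, ?_⟩
  · rcases Int.units_eq_one_or (Equiv.Perm.sign e) with h | h <;> simp [h]
  · funext x t
    have : n = n' ∘ e := funext fun i => (he i).symm
    rw [this]
    exact psiDet_perm_left κ n' Fin.val e x t

/-- The column of ψ_0 = 1 is (1, 0, …, 0), and ψ_{n+1}' = (n + 1)ψ_n reduces the remaining minor to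
the original Wronskian. -/
theorem psiTau_cons_zero_succ (κ : 𝕜) {N : ℕ} (n : Fin N → ℕ) :
    psiTau κ (Fin.cons 0 (fun i => n i + 1) : Fin (N + 1) → ℕ) =
      fun x t => (∏ i, ((n i : 𝕜) + 1)) * psiTau κ n x t := by
  funext x t
  rw [psiTau, psiDet, Matrix.det_succ_column_zero, Fin.sum_univ_succ, Finset.sum_eq_zero]
  · have h := Matrix.det_mul_row (fun j => (n j : 𝕜) + 1)
      (Matrix.of fun i j : Fin N => psiDeriv κ (n j) i x t)
    rw [psiTau, psiDet, ← h]
    simp only [Matrix.of_apply, Fin.cons_zero, Fin.val_zero, pow_zero, one_mul, add_zero]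
    have : psiDeriv κ 0 0 x t = 1 := by simp [psiDeriv, psiPoly_zero]
    rw [this, one_mul]
    congr 1
    ext i j
    simp [psiDeriv_succ_succ]
  · intro i _
    simp [psiDeriv]

variable [CharZero 𝕜]

theorem partialX_psiTau (κ : 𝕜) {N : ℕ} (n : Fin N → ℕ) :
    partialX (psiTau κ n) = psiDetX κ n Fin.val := by
  funext x t
  exact (hasDerivAt_psiDet_x κ n Fin.val x t).deriv

theorem hasDerivAt_psiDetX_x (κ : 𝕜) {N : ℕ} (n r : Fin N → ℕ) (x t : 𝕜) :
    HasDerivAt (fun y => psiDetX κ n r y t)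
      (∑ i, psiDetX κ n (Function.update r i (r i + 1)) x t) x :=
  HasDerivAt.fun_sum fun _ _ => hasDerivAt_psiDet_x κ n _ x t

theorem partialX_partialX_psiTau (κ : 𝕜) {N : ℕ} (n : Fin N → ℕ) (x t : 𝕜) :
    partialX (partialX (psiTau κ n)) x t =
      ∑ i, psiDetX κ n (Function.update Fin.val i (i + 1)) x t := by
  rw [partialX_psiTau]
  exact (hasDerivAt_psiDetX_x κ n Fin.val x t).deriv

theorem partialX_partialX_psiTau_succ (κ : 𝕜) {K : ℕ} (n : Fin (K + 1) → ℕ) (x t : 𝕜) :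
    partialX (partialX (psiTau κ n)) x t = psiDetX κ n (nextRow K) x t := by
  rw [partialX_psiTau]
  have : psiDetX κ n Fin.val = psiDet κ n (nextRow K) := by
    funext x t
    exact psiDetX_val κ n x t
  rw [this]
  exact (hasDerivAt_psiDet_x κ n _ x t).deriv

theorem isHomogeneousOfWeight_psiTau (κ : 𝕜) {N : ℕ} (n : Fin N → ℕ) :
    IsHomogeneousOfWeight κ ((∑ j, (n j : 𝕜)) - ∑ i : Fin N, ((i : ℕ) : 𝕜)) (psiTau κ n) := by
  intro x t ht
  rw [partialX_partialX_psiTau, partialX_psiTau]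
  refine ⟨hasDerivAt_psiDet_t_of_ne κ n Fin.val x t ht, ?_⟩
  refine (HasDerivAt.fun_sum fun i _ => hasDerivAt_psiDet_t_of_ne κ n
    (Function.update Fin.val i ((i : ℕ) + 1)) x t ht).congr_deriv ?_
  -- Each determinant in the x-derivative has total row order one higher, so its weight is one
  -- lower.
  have hs : ∀ i : Fin N, (∑ k, (Function.update Fin.val i ((i : ℕ) + 1) k : 𝕜)) =
      (∑ k : Fin N, ((k : ℕ) : 𝕜)) + 1 := by
    intro i
    rw [← Finset.add_sum_erase Finset.univ _ (Finset.mem_univ i), ← Finset.add_sum_erase Finset.univ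
      (fun k : Fin N => ((k : ℕ) : 𝕜)) (Finset.mem_univ i), Function.update_self,
      Finset.sum_congr rfl fun k hk => by rw [Function.update_of_ne (Finset.ne_of_mem_erase hk)]]
    push_cast
    ring
  simp_rw [hs]
  rw [← Finset.sum_div, Finset.sum_sub_distrib, ← Finset.mul_sum, ← Finset.mul_sum, psiDetX]
  ring

/-- The Plücker relation expresses F_xx G - 2F_x G_x + F G_xx through the sums `psiDetXX` of F and
G, and `psiDet_ode` removes these. The eigenvalue is the difference of the weights: the new index m
minus the new row order N. -/
theorem isDarbouxPair_psiTau_cons (κ : 𝕜) {N : ℕ} (m : ℕ) (n : Fin N → ℕ) :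
    IsDarbouxPair κ (m - N) (psiTau κ (Fin.cons m n : Fin (N + 1) → ℕ)) (psiTau κ n) := by
  intro x t
  have hF := psiDet_ode κ (Fin.cons m n : Fin (N + 1) → ℕ) Fin.val x t
  have hG := psiDet_ode κ n Fin.val x t
  rw [Fin.sum_univ_succ, Fin.sum_univ_castSucc (n := N)] at hF
  simp only [Fin.cons_zero, Fin.cons_succ, Fin.val_castSucc, Fin.val_last] at hF
  cases N with
  -- Here G = 1 and F has a single row, so `psiDetXX` is F_xx itself and the Hermite equation is
  -- already the claim.
  | zero =>
    have h1 := psiDetX_nextRow_add κ (Fin.cons m n : Fin 1 → ℕ) x t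
    have h2 : psiDetXX κ (Fin.cons m n : Fin 1 → ℕ) Fin.val x t =
      psiDet κ (Fin.cons m n : Fin 1 → ℕ) (Function.update Fin.val (Fin.last 0) (0 + 2)) x t := by
      simp [psiDetXX]
    have h3 : psiTau κ n = fun _ _ => 1 := by
      funext x t
      simp [psiTau, psiDet]
    have h4 : ∀ c : 𝕜, partialX (fun _ _ : 𝕜 => c) = fun _ _ => 0 := by
      intro c; funext x t; simp [partialX]
    rw [partialX_partialX_psiTau_succ, partialX_psiTau, h3, h4, h4]
    simp only [Finset.univ_eq_empty, Finset.sum_empty] at hF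
    rw [psiTau]
    linear_combination hF + 6 * t * h1 - 12 * t * h2
  | succ K =>
    have hp := psiDet_plucker κ m n x t
    have h1 := psiDetX_nextRow_sub κ (Fin.cons m n : Fin (K + 2) → ℕ) x t
    have h2 := psiDetX_nextRow_add κ n x t
    rw [partialX_partialX_psiTau_succ, partialX_partialX_psiTau_succ, partialX_psiTau,
      partialX_psiTau, psiTau, psiTau]
    rw [← psiDetX_val, ← psiDetX_val] at hp
    push_cast at hF ⊢
    linear_combination psiDet κ n Fin.val x t * hF
      - psiDet κ (Fin.cons m n : Fin (K + 2) → ℕ) Fin.val x t * hG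
      + 12 * t * hp + 6 * t * psiDet κ n Fin.val x t * h1
      + 6 * t * psiDet κ (Fin.cons m n : Fin (K + 2) → ℕ) Fin.val x t * h2

end Tau

/-! ### Finiteness of the zeros in x, via leading coefficients. -/

section Nonvanishing

open Polynomial in
theorem exists_polynomial_eq_psiPoly {K : Type*} [Field K] [CharZero K] (κ t : K) (n : ℕ) :
    ∃ P : K[X], (∀ x, P.eval x = psiPoly κ n x t) ∧ P.natDegree ≤ n ∧ P.coeff n = 1 := by
  induction n using two_step_induction with
  | h0 => exact ⟨1, by simp [psiPoly_zero], by simp, by simp⟩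
  | h1 =>
    refine ⟨X + C (2 * κ * t), by simp [psiPoly_one], ?_, by simp⟩
    exact (natDegree_X_add_C _).le
  | h n ih1 ih2 =>
    obtain ⟨P, hP, hPd, hPc⟩ := ih1
    obtain ⟨Q, hQ, hQd, hQc⟩ := ih2
    refine ⟨(X + C (2 * κ * t)) * Q + C (6 * t * (n + 1)) * P, fun x => ?_, ?_, ?_⟩
    · simp [hP, hQ, psiPoly_add_two]
    · refine natDegree_add_le_of_degree_le ?_ ?_
      · refine natDegree_mul_le.trans ?_
        rw [natDegree_X_add_C]
        omega
      · refine natDegree_mul_le.trans ?_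
        rw [natDegree_C]
        omega
    · rw [coeff_add, add_mul, coeff_add, coeff_X_mul, coeff_C_mul, coeff_C_mul, hQc,
        coeff_eq_zero_of_natDegree_lt (by omega : Q.natDegree < n + 2),
        coeff_eq_zero_of_natDegree_lt (by omega : P.natDegree < n + 2)]
      simp

open Polynomial in
theorem coeff_prod_sum_of_natDegree_le {R : Type*} [CommSemiring R] {ι : Type*} (s : Finset ι)
    (f : ι → R[X]) (n : ι → ℕ) (h : ∀ i ∈ s, (f i).natDegree ≤ n i) :
    (∏ i ∈ s, f i).natDegree ≤ ∑ i ∈ s, n i ∧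
      (∏ i ∈ s, f i).coeff (∑ i ∈ s, n i) = ∏ i ∈ s, (f i).coeff (n i) := by
  classical
  induction s using Finset.induction_on with
  | empty => simp
  | insert a s ha ih =>
    have ih' := ih fun i hi => h i (Finset.mem_insert_of_mem hi)
    have h1 := h a (Finset.mem_insert_self a s)
    rw [Finset.prod_insert ha, Finset.sum_insert ha, Finset.prod_insert ha]
    refine ⟨natDegree_mul_le.trans (add_le_add h1 ih'.1), ?_⟩
    rw [coeff_mul_add_eq_of_natDegree_le h1 ih'.1, ih'.2]

/-- Falling factorials are monic polynomials of each degree, so this is a Vandermonde determinant in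
the distinct numbers n j. -/
theorem det_descFactorial_ne_zero {K : Type*} [Field K] [CharZero K] {N : ℕ} {n : Fin N → ℕ}
    (hn : Function.Injective n) :
    (Matrix.of fun i j : Fin N => ((n j).descFactorial i : K)).det ≠ 0 := by
  have h := Matrix.det_eval_matrixOfPolynomials_eq_det_vandermonde (fun i => (n i : K))
    (fun i => descPochhammer K i) (fun i => descPochhammer_natDegree K i)
    (fun i => monic_descPochhammer K i)
  have h2 : (Matrix.vandermonde fun i => (n i : K)).det ≠ 0 :=
    Matrix.det_vandermonde_ne_zero_iff.2 fun i j hij => hn (Nat.cast_injective hij)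
  rw [h, ← Matrix.det_transpose] at h2
  convert h2 using 2
  ext i j
  simp [descPochhammer_eval_eq_descFactorial]

open Polynomial in
theorem finite_setOf_psiTau_eq_zero {K : Type*} [Field K] [CharZero K] (κ t : K) {N : ℕ}
    {n : Fin N → ℕ} (hn : Function.Injective n) :
    {x : K | psiDet κ n Fin.val x t = 0}.Finite := by
  choose P hP hPd hPc using exists_polynomial_eq_psiPoly κ t
  -- Multiplying row i by x^i makes every entry of column j have degree at most n j, so the
  -- coefficient of x^(∑ n j) in the determinant is the determinant of the entrywise leading
  -- coefficients.
  set M : Matrix (Fin N) (Fin N) K[X] :=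
    Matrix.of fun i j => X ^ (i : ℕ) * (C ((n j).descFactorial i : K) * P (n j - i)) with hM
  have hev : ∀ x, M.det.eval x = (∏ i : Fin N, x ^ (i : ℕ)) * psiDet κ n Fin.val x t := by
    intro x
    rw [psiDet, ← Matrix.det_mul_column, ← coe_evalRingHom, RingHom.map_det]
    congr 1
    ext i j
    simp [hM, hP, psiDeriv]
  have hdeg : ∀ i j, (M i j).natDegree ≤ n j ∧ (M i j).coeff (n j) = (n j).descFactorial i := by
    intro i j
    simp only [hM, Matrix.of_apply]
    rcases lt_or_ge (n j) i with h | h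
    · simp [Nat.descFactorial_of_lt h]
    · refine ⟨natDegree_mul_le.trans ?_, ?_⟩
      · have h1 := natDegree_C_mul_le ((n j).descFactorial i : K) (P (n j - i))
        have h2 := hPd (n j - i)
        rw [natDegree_X_pow]
        omega
      · obtain ⟨m, hm⟩ := Nat.exists_eq_add_of_le' h
        rw [hm, coeff_X_pow_mul, coeff_C_mul, Nat.add_sub_cancel, hPc, mul_one]
  have hne : M.det ≠ 0 := by
    intro h0
    refine det_descFactorial_ne_zero (K := K) hn ?_
    have := congrArg (fun p : K[X] => p.coeff (∑ j, n j)) h0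
    simp only [coeff_zero] at this
    rw [← this, Matrix.det_apply', Matrix.det_apply', finsetSum_coeff]
    refine Finset.sum_congr rfl fun σ _ => ?_
    rw [← C_eq_intCast, coeff_C_mul,
      (coeff_prod_sum_of_natDegree_le Finset.univ _ n fun i _ => (hdeg (σ i) i).1).2]
    congr 1
    exact Finset.prod_congr rfl fun i _ => (hdeg (σ i) i).2.symm
  refine (M.det.rootSet_finite K).subset fun x hx => ?_
  rw [mem_rootSet]
  refine ⟨hne, ?_⟩
  rw [coe_aeval_eq_eval, hev, show psiDet κ n Fin.val x t = 0 from hx, mul_zero]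

end Nonvanishing

/-! ### The two-run Wronskians and their cycle of three Darboux steps. -/

section PsiWronskian

/-- The indices `1, 4, …, 3a - 2, 2, 5, …, 3b - 1`. -/
def psiIndex (a b : ℕ) : Fin (a + b) → ℕ :=
  Fin.append (fun i : Fin a => 3 * (i : ℕ) + 1) (fun j : Fin b => 3 * (j : ℕ) + 2)

theorem range_psiIndex (a b : ℕ) :
    Set.range (psiIndex a b) = {k | (k % 3 = 1 ∧ k < 3 * a) ∨ (k % 3 = 2 ∧ k < 3 * b)} := by
  ext k
  simp only [Set.mem_range, Set.mem_ofPred_eq]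
  constructor
  · rintro ⟨i, rfl⟩
    refine Fin.addCases (fun i => ?_) (fun j => ?_) i
    · left
      rw [psiIndex, Fin.append_left]
      omega
    · right
      rw [psiIndex, Fin.append_right]
      omega
  · rintro (⟨h, h'⟩ | ⟨h, h'⟩)
    · refine ⟨Fin.castAdd b ⟨k / 3, by omega⟩, ?_⟩
      rw [psiIndex, Fin.append_left]
      simp only
      omega
    · refine ⟨Fin.natAdd a ⟨k / 3, by omega⟩, ?_⟩
      rw [psiIndex, Fin.append_right]
      simp only
      omega

theorem injective_psiIndex (a b : ℕ) : Function.Injective (psiIndex a b) := by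
  intro i j
  refine Fin.addCases (fun i => ?_) (fun i => ?_) i <;>
  refine Fin.addCases (fun j => ?_) (fun j => ?_) j <;>
  simp only [psiIndex, Fin.append_left, Fin.append_right, Fin.ext_iff, Fin.val_castAdd,
    Fin.val_natAdd] <;> omega

theorem injective_cons {N : ℕ} {m : ℕ} {n : Fin N → ℕ} (hn : Function.Injective n)
    (hm : m ∉ Set.range n) : Function.Injective (Fin.cons m n : Fin (N + 1) → ℕ) :=
  Fin.cons_injective_iff.2 ⟨hm, hn⟩

variable {𝕜 : Type*} [NontriviallyNormedField 𝕜] [CharZero 𝕜]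

theorem psiWronskian_eq_psiTau (κ : 𝕜) (a b : ℕ) :
    psiWronskian κ a b = psiTau κ (psiIndex a b) := by
  funext x t
  rw [psiWronskian, wronskianX, psiTau, psiDet]
  congr 1
  ext i j
  have : Fin.append (fun i : Fin a => psiPoly κ (3 * (i : ℕ) + 1))
      (fun j : Fin b => psiPoly κ (3 * (j : ℕ) + 2)) j = psiPoly κ (psiIndex a b j) := by
    refine Fin.addCases (fun i => ?_) (fun i => ?_) j <;>
    simp only [psiIndex, Fin.append_left, Fin.append_right]
  simp only [Matrix.of_apply, this, iteratedDeriv_psiPoly]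

theorem finite_setOf_psiWronskian_eq_zero (κ t : 𝕜) (a b : ℕ) :
    {x : 𝕜 | psiWronskian κ a b x t = 0}.Finite := by
  rw [psiWronskian_eq_psiTau]
  exact finite_setOf_psiTau_eq_zero κ t (injective_psiIndex a b)

theorem contDiff_psiWronskian (κ : 𝕜) (a b : ℕ) :
    ContDiff 𝕜 ∞ (fun p : 𝕜 × 𝕜 => psiWronskian κ a b p.1 p.2) := by
  rw [psiWronskian_eq_psiTau]
  exact contDiff_psiDet κ _ _

/-- The weight of `psiWronskian κ a b`, which is its degree in `x`. -/
noncomputable def psiWeight (𝕜 : Type*) [Field 𝕜] (a b : ℕ) : 𝕜 :=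
  (∑ i ∈ Finset.range a, (3 * (i : 𝕜) + 1)) + (∑ j ∈ Finset.range b, (3 * (j : 𝕜) + 2))
    - ∑ k ∈ Finset.range (a + b), (k : 𝕜)

theorem isHomogeneousOfWeight_psiWronskian (κ : 𝕜) (a b : ℕ) :
    IsHomogeneousOfWeight κ (psiWeight 𝕜 a b) (psiWronskian κ a b) := by
  have h := isHomogeneousOfWeight_psiTau κ (psiIndex a b)
  rw [Fin.sum_univ_add, Fin.sum_univ_eq_sum_range (fun k => (k : 𝕜))] at h
  simp only [psiIndex, Fin.append_left, Fin.append_right, Nat.cast_add, Nat.cast_mul,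
    Nat.cast_ofNat, Nat.cast_one] at h
  rw [Fin.sum_univ_eq_sum_range (fun k => 3 * (k : 𝕜) + 1),
    Fin.sum_univ_eq_sum_range (fun k => 3 * (k : 𝕜) + 2)] at h
  rw [psiWronskian_eq_psiTau]
  exact h

theorem isDarbouxPair_of_range_cons {κ : 𝕜} {N N' : ℕ} {n : Fin N → ℕ} {n' : Fin N' → ℕ} {m : ℕ}
    (hn : Function.Injective n) (hn' : Function.Injective n') (hm : m ∉ Set.range n)
    (h : Set.range n' = insert m (Set.range n)) :
    IsDarbouxPair κ (m - N) (psiTau κ n') (psiTau κ n) := by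
  obtain ⟨k, hk, e⟩ := psiTau_eq_of_range_eq κ (injective_cons hn hm) hn'
    ((Fin.range_cons m n).trans h.symm)
  have h1 := isDarbouxPair_psiTau_cons κ m n
  rw [e] at h1
  refine IsDarbouxPair.of_const_mul hk one_ne_zero ?_
  simpa only [one_mul] using h1

theorem isDarbouxPair_psiWronskian_left (κ : 𝕜) (a b : ℕ) :
    IsDarbouxPair κ (2 * a - b + 1) (psiWronskian κ (a + 1) b) (psiWronskian κ a b) := by
  rw [psiWronskian_eq_psiTau, psiWronskian_eq_psiTau]
  have h := isDarbouxPair_of_range_cons (κ := κ) (m := 3 * a + 1) (injective_psiIndex a b)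
    (injective_psiIndex (a + 1) b) (by rw [range_psiIndex]; simp only [Set.mem_ofPred_eq]; omega)
    (by
      rw [range_psiIndex, range_psiIndex]; ext k
      simp only [Set.mem_ofPred_eq, Set.mem_insert_iff]; omega)
  convert h using 1
  push_cast
  ring

theorem isDarbouxPair_psiWronskian_right (κ : 𝕜) (a b : ℕ) :
    IsDarbouxPair κ (2 * b - a + 2) (psiWronskian κ a (b + 1)) (psiWronskian κ a b) := by
  rw [psiWronskian_eq_psiTau, psiWronskian_eq_psiTau]
  have h := isDarbouxPair_of_range_cons (κ := κ) (m := 3 * b + 2) (injective_psiIndex a b)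
    (injective_psiIndex a (b + 1)) (by rw [range_psiIndex]; simp only [Set.mem_ofPred_eq]; omega)
    (by
      rw [range_psiIndex, range_psiIndex]; ext k
      simp only [Set.mem_ofPred_eq, Set.mem_insert_iff]; omega)
  convert h using 1
  push_cast
  ring

theorem exists_psiTau_shift (κ : 𝕜) {N : ℕ} {n : Fin N → ℕ} (hn : Function.Injective n) :
    ∃ (n' : Fin (N + 1) → ℕ) (k : 𝕜), Function.Injective n' ∧
      Set.range n' = {j | j = 0 ∨ (j ≠ 0 ∧ j - 1 ∈ Set.range n)} ∧ k ≠ 0 ∧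
      psiTau κ n' = fun x t => k * psiTau κ n x t := by
  refine ⟨Fin.cons 0 fun i => n i + 1, _, ?_, ?_, ?_, psiTau_cons_zero_succ κ n⟩
  · refine injective_cons (fun i j h => hn (Nat.succ_injective h)) ?_
    simp
  · rw [Fin.range_cons]
    ext j
    simp only [Set.mem_insert_iff, Set.mem_range, Set.mem_ofPred_eq]
    refine or_congr_right ⟨?_, ?_⟩
    · rintro ⟨i, rfl⟩
      exact ⟨by omega, i, by omega⟩
    · rintro ⟨h, i, hi⟩
      exact ⟨i, by omega⟩
  · exact Finset.prod_ne_zero_iff.2 fun i _ => by exact_mod_cast (n i).succ_ne_zero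

/-- The step that closes the cycle: the index set of (a, b) shifted by 3, with 0, 1, 2 added, is the
index set of (a + 1, b + 1) with 0 added. -/
theorem isDarbouxPair_psiWronskian_lower (κ : 𝕜) (a b : ℕ) :
    IsDarbouxPair κ (-(a + b + 2)) (psiWronskian κ a b) (psiWronskian κ (a + 1) (b + 1)) := by
  rw [psiWronskian_eq_psiTau, psiWronskian_eq_psiTau]
  -- Each shift raises all indices by one and adjoins 0; three shifts preserve residues modulo 3.
  obtain ⟨n1, k1, i1, r1, hk1, e1⟩ := exists_psiTau_shift κ (injective_psiIndex a b)
  obtain ⟨n2, k2, i2, r2, hk2, e2⟩ := exists_psiTau_shift κ i1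
  obtain ⟨n3, k3, i3, r3, hk3, e3⟩ := exists_psiTau_shift κ i2
  have h := isDarbouxPair_of_range_cons (κ := κ) (m := 0) (injective_psiIndex (a + 1) (b + 1))
    i3 (by rw [range_psiIndex]; simp only [Set.mem_ofPred_eq]; omega)
    (by
      rw [r3, r2, r1, range_psiIndex, range_psiIndex]; ext k
      simp only [Set.mem_ofPred_eq, Set.mem_insert_iff]; omega)
  rw [e3, e2, e1] at h
  refine IsDarbouxPair.of_const_mul (mul_ne_zero hk3 (mul_ne_zero hk2 hk1)) one_ne_zero ?_
  convert h using 1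
  · push_cast; ring
  · funext x t; ring
  · funext x t; ring

end PsiWronskian

/-! ### Calculus of partial derivatives on open sets. -/

section PartialDerivatives

variable {𝕜 : Type*} [NontriviallyNormedField 𝕜] {D : Set (𝕜 × 𝕜)} {U V W : 𝕜 → 𝕜 → 𝕜}

theorem eventually_mk_mem_left (hD : IsOpen D) {x t : 𝕜} (h : (x, t) ∈ D) :
    ∀ᶠ y in nhds x, (y, t) ∈ D :=
  (Continuous.prodMk_left t).continuousAt.eventually (hD.mem_nhds h)

theorem eventually_mk_mem_right (hD : IsOpen D) {x t : 𝕜} (h : (x, t) ∈ D) :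
    ∀ᶠ s in nhds t, (x, s) ∈ D :=
  (Continuous.prodMk_right x).continuousAt.eventually (hD.mem_nhds h)

theorem partialX_eq_of_hasDerivAt (hD : IsOpen D) (h : ∀ x t, (x, t) ∈ D → V x t = W x t)
    {x t w : 𝕜} (hx : (x, t) ∈ D) (hw : HasDerivAt (fun y => W y t) w x) :
    partialX V x t = w :=
  (hw.congr_of_eventuallyEq ((eventually_mk_mem_left hD hx).mono fun y hy => h y t hy)).deriv

theorem partialT_eq_of_hasDerivAt (hD : IsOpen D) (h : ∀ x t, (x, t) ∈ D → V x t = W x t)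
    {x t w : 𝕜} (hx : (x, t) ∈ D) (hw : HasDerivAt (fun s => W x s) w t) :
    partialT V x t = w :=
  (hw.congr_of_eventuallyEq ((eventually_mk_mem_right hD hx).mono fun s hs => h x s hs)).deriv

theorem hasDerivAt_partialX (hD : IsOpen D)
    (hU : ContDiffOn 𝕜 ∞ (fun p : 𝕜 × 𝕜 => U p.1 p.2) D) {x t : 𝕜} (h : (x, t) ∈ D) :
    HasDerivAt (fun y => U y t) (fderiv 𝕜 (fun p : 𝕜 × 𝕜 => U p.1 p.2) (x, t) (1, 0)) x := by
  have h1 := ((hU.contDiffAt (hD.mem_nhds h)).differentiableAt (by simp)).hasFDerivAt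
  exact h1.comp_hasDerivAt_of_eq x ((hasDerivAt_id x).prodMk (hasDerivAt_const x t)) rfl

theorem hasDerivAt_partialT (hD : IsOpen D)
    (hU : ContDiffOn 𝕜 ∞ (fun p : 𝕜 × 𝕜 => U p.1 p.2) D) {x t : 𝕜} (h : (x, t) ∈ D) :
    HasDerivAt (fun s => U x s) (fderiv 𝕜 (fun p : 𝕜 × 𝕜 => U p.1 p.2) (x, t) (0, 1)) t := by
  have h1 := ((hU.contDiffAt (hD.mem_nhds h)).differentiableAt (by simp)).hasFDerivAt
  exact h1.comp_hasDerivAt_of_eq t ((hasDerivAt_const t x).prodMk (hasDerivAt_id t)) rfl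

theorem contDiffOn_partialX (hD : IsOpen D)
    (hU : ContDiffOn 𝕜 ∞ (fun p : 𝕜 × 𝕜 => U p.1 p.2) D) :
    ContDiffOn 𝕜 ∞ (fun p : 𝕜 × 𝕜 => partialX U p.1 p.2) D :=
  ((hU.fderiv_of_isOpen hD (m := ∞) (by simp)).clm_apply contDiffOn_const).congr
    fun _ hp => (hasDerivAt_partialX hD hU hp).deriv

theorem contDiffOn_partialT (hD : IsOpen D)
    (hU : ContDiffOn 𝕜 ∞ (fun p : 𝕜 × 𝕜 => U p.1 p.2) D) :
    ContDiffOn 𝕜 ∞ (fun p : 𝕜 × 𝕜 => partialT U p.1 p.2) D :=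
  ((hU.fderiv_of_isOpen hD (m := ∞) (by simp)).clm_apply contDiffOn_const).congr
    fun _ hp => (hasDerivAt_partialT hD hU hp).deriv

/-- The dispersive water wave operator. -/
noncomputable def dwwOperator (U : 𝕜 → 𝕜 → 𝕜) (x t : 𝕜) : 𝕜 :=
  partialT (partialT U) x t
    + 2 * partialT U x t * partialX (partialX U) x t
    + 4 * partialX U x t * partialT (partialX U) x t
    + 6 * partialX U x t ^ 2 * partialX (partialX U) x t
    - partialX (partialX (partialX (partialX U))) x t

theorem continuousOn_dwwOperator (hD : IsOpen D)
    (hU : ContDiffOn 𝕜 ∞ (fun p : 𝕜 × 𝕜 => U p.1 p.2) D) :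
    ContinuousOn (fun p : 𝕜 × 𝕜 => dwwOperator U p.1 p.2) D := by
  have hx := contDiffOn_partialX hD hU
  have ht := contDiffOn_partialT hD hU
  have hxx := contDiffOn_partialX hD hx
  have hxt := contDiffOn_partialT hD hx
  have htt := contDiffOn_partialT hD ht
  have hx4 := contDiffOn_partialX hD (contDiffOn_partialX hD hxx)
  have cx := hx.continuousOn
  have ct := ht.continuousOn
  have cxx := hxx.continuousOn
  exact (((htt.continuousOn.add ((continuousOn_const.mul ct).mul cxx)).add
    ((continuousOn_const.mul cx).mul hxt.continuousOn)).add
    ((continuousOn_const.mul (cx.pow 2)).mul cxx)).sub hx4.continuousOn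

/-- It suffices to check the equation off a set with finite horizontal sections. -/
theorem isDWWSolutionOn_of_finite_exceptions (hD : IsOpen D)
    (hU : ContDiffOn 𝕜 ∞ (fun p : 𝕜 × 𝕜 => U p.1 p.2) D) (C : 𝕜 → 𝕜 → 𝕜)
    (hC : ∀ t, {x | C x t = 0}.Finite)
    (h : ∀ x t, (x, t) ∈ D → C x t ≠ 0 → dwwOperator U x t = 0) : IsDWWSolutionOn D U := by
  refine ⟨hU, fun x t hxt => ?_⟩
  change dwwOperator U x t = 0
  have h1 : Filter.Tendsto (fun y => dwwOperator U y t) (nhdsWithin x {x}ᶜ)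
      (nhds (dwwOperator U x t)) := by
    have := ((continuousOn_dwwOperator hD hU).continuousAt (hD.mem_nhds hxt)).comp
      (f := fun y : 𝕜 => (y, t)) (Continuous.prodMk_left t).continuousAt
    exact this.tendsto.mono_left nhdsWithin_le_nhds
  -- A small punctured neighbourhood of x on the horizontal line avoids the finitely many
  -- exceptions; the value at x is then a limit of zeros.
  have h2 : ∀ᶠ y in nhdsWithin x {x}ᶜ, dwwOperator U y t = 0 := by
    have h3 : ∀ᶠ y in nhdsWithin x {x}ᶜ, C y t ≠ 0 := by
      have h4 : ({x | C x t = 0} \ {x})ᶜ ∈ nhds x :=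
        ((hC t).subset Set.sdiff_subset).isClosed.isOpen_compl.mem_nhds (by simp)
      filter_upwards [nhdsWithin_le_nhds h4, self_mem_nhdsWithin] with y hy hyx h0
      exact hy ⟨h0, hyx⟩
    filter_upwards [nhdsWithin_le_nhds (eventually_mk_mem_left hD hxt), h3] with y hy hy'
    exact h y t hy hy'
  exact tendsto_nhds_unique h1
    (tendsto_const_nhds.congr' (h2.mono fun y hy => hy.symm))

end PartialDerivatives

/-! ### From the dressing chain to the dispersive water wave equation. -/

section Reduction

variable {𝕜 : Type*} [NontriviallyNormedField 𝕜] [CharZero 𝕜]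

/-- Solutions of the dressing chain with three factors solve the dispersive water wave equation. -/
theorem dwwOperator_eq_zero_of_dressing_chain {D : Set (𝕜 × 𝕜)} (hD : IsOpen D) {κ d k : 𝕜}
    {U p q : 𝕜 → 𝕜 → 𝕜} (ht : ∀ x t, (x, t) ∈ D → t ≠ 0)
    (hUx : ∀ x t, (x, t) ∈ D → partialX U x t = p x t + x / (3 * t) - κ / 3)
    (hUt : ∀ x t, (x, t) ∈ D → partialT U x t =
      (d - (x - 2 * κ * t) * p x t) / (2 * t) - x ^ 2 / (6 * t ^ 2) - κ ^ 2 / 3 - d / t)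
    (hpx : ∀ x t, (x, t) ∈ D → HasDerivAt (fun y => p y t)
      (k / (6 * t) - q x t * ((x + 2 * κ * t) / (6 * t) - p x t)) x)
    (hqx : ∀ x t, (x, t) ∈ D → HasDerivAt (fun y => q y t)
      (-d / (2 * t) + (x + 2 * κ * t) * p x t / (2 * t) + (3 * p x t ^ 2 - q x t ^ 2) / 2) x)
    (hpt : ∀ x t, (x, t) ∈ D → HasDerivAt (fun s => p x s)
      ((-p x t - (x - 2 * κ * t) *
        (k / (6 * t) - q x t * ((x + 2 * κ * t) / (6 * t) - p x t))) / (2 * t)) t)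
    (x t : 𝕜) (hxt : (x, t) ∈ D) : dwwOperator U x t = 0 := by
  have hX : ∀ (c x t : 𝕜), HasDerivAt (fun y => (y + 2 * κ * t) / c) (1 / c) x := fun c x t =>
    ((hasDerivAt_id x).add_const _).div_const c
  have h1 : ∀ x t, (x, t) ∈ D → partialX (partialX U) x t =
      k / (6 * t) - q x t * ((x + 2 * κ * t) / (6 * t) - p x t) + 1 / (3 * t) := fun x t h =>
    partialX_eq_of_hasDerivAt hD hUx h
      (((hpx x t h).add ((hasDerivAt_id x).div_const (3 * t))).sub_const (κ / 3))
  have h2 : ∀ x t, (x, t) ∈ D → partialX (partialX (partialX U)) x t =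
      -((-d / (2 * t) + (x + 2 * κ * t) * p x t / (2 * t) + (3 * p x t ^ 2 - q x t ^ 2) / 2)
        * ((x + 2 * κ * t) / (6 * t) - p x t) + q x t * (1 / (6 * t) -
        (k / (6 * t) - q x t * ((x + 2 * κ * t) / (6 * t) - p x t)))) := fun x t h =>
    partialX_eq_of_hasDerivAt hD h1 h
      ((((hqx x t h).mul ((hX (6 * t) x t).sub (hpx x t h))).const_sub (k / (6 * t))).add_const
        (1 / (3 * t)))
  have hqx' : ∀ x t, (x, t) ∈ D → HasDerivAt (fun y => -d / (2 * t) +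
      (y + 2 * κ * t) * p y t / (2 * t) + (3 * p y t ^ 2 - q y t ^ 2) / 2) _ x := fun x t h =>
    ((((((hasDerivAt_id x).add_const (2 * κ * t)).mul (hpx x t h)).div_const (2 * t)).const_add
      (-d / (2 * t))).add (((((hpx x t h).pow 2).const_mul 3).sub ((hqx x t h).pow 2)).div_const 2))
  have h3 := partialX_eq_of_hasDerivAt hD h2 hxt
    (((hqx' x t hxt).mul ((hX (6 * t) x t).sub (hpx x t hxt))).add ((hqx x t hxt).mul
      ((((hqx x t hxt).mul ((hX (6 * t) x t).sub (hpx x t hxt))).const_sub (k / (6 * t))).const_sub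
        (1 / (6 * t))))).neg
  have ht0 := ht x t hxt
  have h6 : (6 * t : 𝕜) ≠ 0 := mul_ne_zero (by norm_num) ht0
  -- U_x and U_t involve p but not q, so the t-derivative of q is never needed.
  have h4 := partialT_eq_of_hasDerivAt hD hUx hxt
    (((hpt x t hxt).add ((hasDerivAt_const t x).div ((hasDerivAt_id t).const_mul 3)
      (mul_ne_zero (by norm_num) ht0))).sub_const (κ / 3))
  have h5 := partialT_eq_of_hasDerivAt hD hUt hxt
    (((((((((hasDerivAt_id t).const_mul (2 * κ)).const_sub x).mul (hpt x t hxt)).const_sub d).div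
      ((hasDerivAt_id t).const_mul 2) (mul_ne_zero (by norm_num) ht0)).sub
      ((hasDerivAt_const t (x ^ 2)).div (((hasDerivAt_id t).pow 2).const_mul 6)
        (mul_ne_zero (by norm_num) (pow_ne_zero 2 ht0)))).sub_const (κ ^ 2 / 3)).sub
      ((hasDerivAt_const t d).div (hasDerivAt_id t) ht0))
  rw [dwwOperator, h5, h4, h3, h1 x t hxt, hUx x t hxt, hUt x t hxt]
  simp only [id, Pi.sub_apply, Pi.mul_apply, Pi.pow_apply]
  -- All derivatives are now rational in x, t, p, q, and the equation is an identity with p and q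
  -- treated as independent.
  generalize p x t = P
  generalize q x t = Q
  field_simp
  ring

end Reduction

/-! ### From a cycle of three Darboux pairs to the dressing chain. -/

section Cycle

variable {𝕜 : Type*} [NontriviallyNormedField 𝕜]

/-- `L` is a smooth logarithm of `f` on `D`, up to locally constant functions. -/
structure IsSmoothLogOn (D : Set (𝕜 × 𝕜)) (L f : 𝕜 → 𝕜 → 𝕜) : Prop where
  contDiffOn : ContDiffOn 𝕜 ∞ (fun p : 𝕜 × 𝕜 => L p.1 p.2) D
  ne_zero : ∀ x t, (x, t) ∈ D → f x t ≠ 0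
  hasDerivAt_left : ∀ x t, (x, t) ∈ D → HasDerivAt (fun y => L y t) (partialX f x t / f x t) x
  hasDerivAt_right : ∀ x t, (x, t) ∈ D → HasDerivAt (fun s => L x s) (partialT f x t / f x t) t

theorem hasDerivAt_x_of_contDiff {F : 𝕜 → 𝕜 → 𝕜}
    (hF : ContDiff 𝕜 ∞ (fun p : 𝕜 × 𝕜 => F p.1 p.2)) (x t : 𝕜) :
    HasDerivAt (fun y => F y t) (partialX F x t) x :=
  (hasDerivAt_partialX isOpen_univ hF.contDiffOn (Set.mem_univ (x, t))).differentiableAt.hasDerivAt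

theorem contDiff_partialX {F : 𝕜 → 𝕜 → 𝕜}
    (hF : ContDiff 𝕜 ∞ (fun p : 𝕜 × 𝕜 => F p.1 p.2)) :
    ContDiff 𝕜 ∞ (fun p : 𝕜 × 𝕜 => partialX F p.1 p.2) :=
  contDiffOn_univ.1 (contDiffOn_partialX isOpen_univ hF.contDiffOn)

theorem IsDarbouxPair.logDeriv {κ d : 𝕜} {F G : 𝕜 → 𝕜 → 𝕜} (h : IsDarbouxPair κ d F G) {x t : 𝕜}
    (hF : F x t ≠ 0) (hG : G x t ≠ 0) :
    6 * t * (partialX (partialX F) x t / F x t - 2 * (partialX F x t / F x t *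
      (partialX G x t / G x t)) + partialX (partialX G) x t / G x t)
      + (x + 2 * κ * t) * (partialX F x t / F x t - partialX G x t / G x t) = d := by
  have := h x t
  field_simp
  linear_combination this

variable [CharZero 𝕜]

/-- The logarithmic ratio of two neighbours in a cycle of three Darboux transformations, corrected
by a Gaussian factor, solves the dispersive water wave equation. -/
theorem isDWWSolutionOn_of_darboux_cycle {κ d₁ d₂ d₃ w : 𝕜} {A B C : 𝕜 → 𝕜 → 𝕜}
    (cA : ContDiff 𝕜 ∞ (fun p : 𝕜 × 𝕜 => A p.1 p.2))
    (cB : ContDiff 𝕜 ∞ (fun p : 𝕜 × 𝕜 => B p.1 p.2))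
    (cC : ContDiff 𝕜 ∞ (fun p : 𝕜 × 𝕜 => C p.1 p.2))
    (hA : IsHomogeneousOfWeight κ w A) (hB : IsHomogeneousOfWeight κ (w + d₁) B)
    (h₁ : IsDarbouxPair κ d₁ B A) (h₂ : IsDarbouxPair κ d₂ C B) (h₃ : IsDarbouxPair κ d₃ A C)
    (hd : d₁ + d₂ + d₃ = 0) (hC : ∀ t, {x | C x t = 0}.Finite)
    {D : Set (𝕜 × 𝕜)} (hD : IsOpen D) {U L l : 𝕜 → 𝕜 → 𝕜}
    (hL : IsSmoothLogOn D L (fun x t => B x t / A x t))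
    (hl : IsSmoothLogOn D l (fun _ t => t))
    (hU : ∀ x t, U x t = L x t + x ^ 2 / (6 * t) - 1 / 3 * κ * (x + κ * t) - d₁ * l x t) :
    IsDWWSolutionOn D U := by
  have ht0 : ∀ x t, (x, t) ∈ D → t ≠ 0 := hl.ne_zero
  -- Since division by zero gives 0, a non-zero quotient B / A forces A ≠ 0.
  have hA0 : ∀ x t, (x, t) ∈ D → A x t ≠ 0 := fun x t h h0 => hL.ne_zero x t h (by simp [h0])
  have hB0 : ∀ x t, (x, t) ∈ D → B x t ≠ 0 := fun x t h h0 => hL.ne_zero x t h (by simp [h0])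
  have hU' : U = fun x t =>
      L x t + x ^ 2 / (6 * t) - 1 / 3 * κ * (x + κ * t) - d₁ * l x t := by
    funext x t; exact hU x t
  have h6 : (6 : 𝕜) ≠ 0 := by norm_num
  have dx := fun x t => hasDerivAt_x_of_contDiff cA x t
  have dxB := fun x t => hasDerivAt_x_of_contDiff cB x t
  have dxC := fun x t => hasDerivAt_x_of_contDiff cC x t
  have dxx := fun x t => hasDerivAt_x_of_contDiff (contDiff_partialX cA) x t
  have dxxB := fun x t => hasDerivAt_x_of_contDiff (contDiff_partialX cB) x t
  have dxxC := fun x t => hasDerivAt_x_of_contDiff (contDiff_partialX cC) x t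
  have cU : ContDiffOn 𝕜 ∞ (fun p : 𝕜 × 𝕜 => U p.1 p.2) D := by
    rw [hU']
    refine ((hL.contDiffOn.add ?_).sub ?_).sub (contDiffOn_const.mul hl.contDiffOn)
    · exact (contDiffOn_fst.pow 2).div (contDiffOn_const.mul contDiffOn_snd)
        fun p hp => mul_ne_zero h6 (ht0 p.1 p.2 hp)
    · exact contDiffOn_const.mul (contDiffOn_fst.add (contDiffOn_const.mul contDiffOn_snd))
  refine isDWWSolutionOn_of_finite_exceptions hD cU C hC fun x₀ t₀ hxt₀ hC₀ => ?_
  -- The logarithmic derivative of C enters q, so the chain is set up away from the zeros of C.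
  have hD' : IsOpen {p : 𝕜 × 𝕜 | p ∈ D ∧ C p.1 p.2 ≠ 0} :=
    hD.inter (isOpen_ne_fun cC.continuous continuous_const)
  refine dwwOperator_eq_zero_of_dressing_chain hD' (κ := κ) (d := d₁) (k := d₂ - d₃)
    (p := fun x t => partialX B x t / B x t - partialX A x t / A x t)
    (q := fun x t => 2 * (partialX C x t / C x t) - partialX B x t / B x t
      - partialX A x t / A x t) (fun x t h => ht0 x t h.1) ?_ ?_ ?_ ?_ ?_ x₀ t₀ ⟨hxt₀, hC₀⟩
  · rintro x t ⟨h, -⟩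
    have a0 := hA0 x t h
    have b0 := hB0 x t h
    have t0 := ht0 x t h
    have hf : partialX (fun x t => B x t / A x t) x t = _ := ((dxB x t).div (dx x t) a0).deriv
    have h' := (((hL.hasDerivAt_left x t h).add (((hasDerivAt_id x).pow 2).div_const (6 * t))).sub
      (((hasDerivAt_id x).add_const (κ * t)).const_mul (1 / 3 * κ))).sub
      ((hl.hasDerivAt_left x t h).const_mul d₁)
    have hl0 : partialX (fun _ t : 𝕜 => t) x t = 0 := by simp [partialX]
    rw [hl0, hf] at h'
    rw [hU']
    refine h'.deriv.trans ?_
    simp only [id]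
    field_simp
    ring
  · rintro x t ⟨h, -⟩
    have a0 := hA0 x t h
    have b0 := hB0 x t h
    have t0 := ht0 x t h
    have hf : partialT (fun x t => B x t / A x t) x t = _ :=
      (((hB x t t0).1).div ((hA x t t0).1) a0).deriv
    have h' := (((hL.hasDerivAt_right x t h).add ((hasDerivAt_const t (x ^ 2)).div
      ((hasDerivAt_id t).const_mul 6) (mul_ne_zero h6 t0))).sub
      ((((hasDerivAt_id t).const_mul κ).const_add x).const_mul (1 / 3 * κ))).sub
      ((hl.hasDerivAt_right x t h).const_mul d₁)
    have hl0 : partialT (fun _ t : 𝕜 => t) x t = 1 := by simp [partialT]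
    rw [hl0, hf] at h'
    rw [hU']
    refine h'.deriv.trans ?_
    simp only [id]
    field_simp
    ring
  · rintro x t ⟨h, c0⟩
    have a0 := hA0 x t h
    have b0 := hB0 x t h
    have t0 := ht0 x t h
    have e2 := h₂.logDeriv c0 b0
    have e3 := h₃.logDeriv a0 c0
    refine (((dxxB x t).div (dxB x t) b0).sub ((dxx x t).div (dx x t) a0)).congr_deriv ?_
    have n : ∀ f f1 f2 : 𝕜, f ≠ 0 → (f2 * f - f1 * f1) / f ^ 2 = f2 / f - (f1 / f) ^ 2 := by
      intro f f1 f2 hf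
      field_simp
    rw [n _ _ _ a0, n _ _ _ b0]
    generalize partialX A x t / A x t = a at *
    generalize partialX B x t / B x t = b at *
    generalize partialX C x t / C x t = c at *
    generalize partialX (partialX A) x t / A x t = a2 at *
    generalize partialX (partialX B) x t / B x t = b2 at *
    generalize partialX (partialX C) x t / C x t = c2 at *
    field_simp
    -- The difference of the two relations containing C cancels C_xx / C.
    linear_combination e2 - e3
  · rintro x t ⟨h, c0⟩
    have a0 := hA0 x t h
    have b0 := hB0 x t h
    have t0 := ht0 x t h
    have e1 := h₁.logDeriv b0 a0
    have e2 := h₂.logDeriv c0 b0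
    have e3 := h₃.logDeriv a0 c0
    refine (((((dxxC x t).div (dxC x t) c0).const_mul 2).sub ((dxxB x t).div (dxB x t) b0)).sub
      ((dxx x t).div (dx x t) a0)).congr_deriv ?_
    have n : ∀ f f1 f2 : 𝕜, f ≠ 0 → (f2 * f - f1 * f1) / f ^ 2 = f2 / f - (f1 / f) ^ 2 := by
      intro f f1 f2 hf
      field_simp
    rw [n _ _ _ a0, n _ _ _ b0, n _ _ _ c0]
    generalize partialX A x t / A x t = a at *
    generalize partialX B x t / B x t = b at *
    generalize partialX C x t / C x t = c at *
    generalize partialX (partialX A) x t / A x t = a2 at *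
    generalize partialX (partialX B) x t / B x t = b2 at *
    generalize partialX (partialX C) x t / C x t = c2 at *
    field_simp
    -- e2 + e3 - 2 e1 isolates the second derivatives in q_x; as the eigenvalues sum to zero, its
    -- constant is -3 d₁.
    linear_combination (1 / 3 : 𝕜) * (e2 + e3 - 2 * e1 + hd)
  · rintro x t ⟨h, c0⟩
    have a0 := hA0 x t h
    have b0 := hB0 x t h
    have t0 := ht0 x t h
    have e2 := h₂.logDeriv c0 b0
    have e3 := h₃.logDeriv a0 c0
    refine ((((hB x t t0).2).div ((hB x t t0).1) b0).sub
      (((hA x t t0).2).div ((hA x t t0).1) a0)).congr_deriv ?_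
    have n : ∀ d f f1 f2 : 𝕜, f ≠ 0 → (((d - 1) * f1 - (x - 2 * κ * t) * f2) / (2 * t) * f -
        f1 * ((d * f - (x - 2 * κ * t) * f1) / (2 * t))) / f ^ 2 =
        (-(f1 / f) - (x - 2 * κ * t) * (f2 / f - (f1 / f) ^ 2)) / (2 * t) := by
      intro d f f1 f2 hf
      field_simp
      ring
    rw [n _ _ _ _ a0, n _ _ _ _ b0]
    generalize partialX A x t / A x t = a at *
    generalize partialX B x t / B x t = b at *
    generalize partialX C x t / C x t = c at *
    generalize partialX (partialX A) x t / A x t = a2 at *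
    generalize partialX (partialX B) x t / B x t = b2 at *
    generalize partialX (partialX C) x t / C x t = c2 at *
    have e : b2 - b ^ 2 - (a2 - a ^ 2) = (d₂ - d₃) / (6 * t) -
        (2 * c - b - a) * ((x + 2 * κ * t) / (6 * t) - (b - a)) := by
      field_simp
      linear_combination e2 - e3
    rw [← e]
    ring

end Cycle

/-! ### Real logarithms and complex branches as smooth logarithms. -/

section Logarithms

theorem isSmoothLogOn_real_log {D : Set (ℝ × ℝ)} (hD : IsOpen D) {f : ℝ → ℝ → ℝ}
    (hf : ContDiffOn ℝ ∞ (fun p : ℝ × ℝ => f p.1 p.2) D) (h0 : ∀ x t, (x, t) ∈ D → f x t ≠ 0) :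
    IsSmoothLogOn D (fun x t => Real.log (f x t)) f where
  contDiffOn := hf.log fun p hp => h0 p.1 p.2 hp
  ne_zero := h0
  hasDerivAt_left x t h :=
    ((hasDerivAt_partialX hD hf h).differentiableAt.hasDerivAt).log (h0 x t h)
  hasDerivAt_right x t h :=
    ((hasDerivAt_partialT hD hf h).differentiableAt.hasDerivAt).log (h0 x t h)

/-- A continuous branch is locally a constant plus the principal logarithm of a function near 1,
hence holomorphic. -/
theorem IsLogBranchOn.isSmoothLogOn {D : Set (ℂ × ℂ)} (hD : IsOpen D) {L f : ℂ → ℂ → ℂ}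
    (hL : IsLogBranchOn D L f) (hf : ContDiffOn ℂ ∞ (fun p : ℂ × ℂ => f p.1 p.2) D) :
    IsSmoothLogOn D L f := by
  obtain ⟨hc, he⟩ := hL
  have h0 : ∀ x t, (x, t) ∈ D → f x t ≠ 0 := fun x t h => by
    rw [← he x t h]; exact Complex.exp_ne_zero _
  have hs : ContDiffOn ℂ ∞ (fun p : ℂ × ℂ => L p.1 p.2) D := by
    rintro ⟨x, t⟩ h
    refine ContDiffAt.contDiffWithinAt ?_
    have h1 : ContDiffAt ℂ ∞ (fun p : ℂ × ℂ => L x t + Complex.log (f p.1 p.2 / f x t)) (x, t) := by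
      have h2 : f x t / f x t ∈ Complex.slitPlane := by simp [div_self (h0 x t h)]
      exact contDiffAt_const.add (ContDiffAt.comp (g := Complex.log)
        (f := fun p : ℂ × ℂ => f p.1 p.2 / f x t) (x, t) (Complex.contDiffAt_log h2)
        ((hf.contDiffAt (hD.mem_nhds h)).div_const _))
    refine h1.congr_of_eventuallyEq ?_
    -- By continuity the imaginary part of L - L(x, t) stays in (-π, π) near the point, so the
    -- principal logarithm inverts the exponential there.
    have h2 : Filter.Tendsto (fun p : ℂ × ℂ => (L p.1 p.2 - L x t).im) (nhds (x, t)) (nhds 0) := by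
      have h3 := (Complex.continuous_im.continuousAt.comp
        ((hc.continuousAt (hD.mem_nhds h)).sub (continuousAt_const (y := L x t)))).tendsto
      simpa [Function.comp_def] using h3
    filter_upwards [hD.mem_nhds h, h2.eventually (Ioo_mem_nhds (neg_lt_zero.2 Real.pi_pos)
      Real.pi_pos)] with p hp hp'
    rw [← he p.1 p.2 hp, ← he x t h, ← Complex.exp_sub, Complex.log_exp hp'.1 hp'.2.le]
    ring
  refine ⟨hs, h0, fun x t h => ?_, fun x t h => ?_⟩
  · have h1 := (hasDerivAt_partialX hD hs h).differentiableAt.hasDerivAt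
    have h2 := partialX_eq_of_hasDerivAt hD (fun x t h => (he x t h).symm) h h1.cexp
    rw [h2, he x t h, mul_div_cancel_left₀ _ (h0 x t h)]
    exact h1
  · have h1 := (hasDerivAt_partialT hD hs h).differentiableAt.hasDerivAt
    have h2 := partialT_eq_of_hasDerivAt hD (fun x t h => (he x t h).symm) h h1.cexp
    rw [h2, he x t h, mul_div_cancel_left₀ _ (h0 x t h)]
    exact h1

end Logarithms

/-! ### Comparison with the Hermite polynomials. -/

section Hermite

/-- At t = -1/3 and κ = 0 the generating function is exp(2zλ - λ²), that of the Hermite polynomials.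
-/
theorem iteratedDeriv_exp_neg_sq (n : ℕ) :
    iteratedDeriv n (fun w : ℂ => Complex.exp (-w ^ 2)) =
      fun z => (-1) ^ n * Complex.exp (-z ^ 2) * psiPoly 0 n (2 * z) (-1 / 3) := by
  induction n with
  | zero => funext z; simp [psiPoly_zero]
  | succ n ih =>
    rw [iteratedDeriv_succ, ih]
    funext z
    have h1 : HasDerivAt (fun w : ℂ => psiPoly 0 n (2 * w) (-1 / 3)) _ z :=
      (hasDerivAt_psiPoly_x (0 : ℂ) n (2 * z) (-1 / 3)).comp z ((hasDerivAt_id z).const_mul 2)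
    have h2 : HasDerivAt (fun w : ℂ => (-1) ^ n * Complex.exp (-w ^ 2)) _ z :=
      (((hasDerivAt_id z).pow 2).neg.cexp).const_mul ((-1) ^ n)
    refine (h2.mul h1).deriv.trans ?_
    rw [psiPoly_succ]
    simp only [id, Pi.pow_apply, Pi.neg_apply]
    push_cast
    ring

theorem hermiteH_eq_psiPoly (n : ℕ) (z : ℂ) : hermiteH n z = psiPoly 0 n (2 * z) (-1 / 3) := by
  rw [hermiteH, iteratedDeriv_exp_neg_sq]
  beta_reduce
  rw [Complex.exp_neg]
  have h := Complex.exp_ne_zero (z ^ 2)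
  have h1 : ((-1 : ℂ) ^ n) * (-1) ^ n = 1 := by rw [← mul_pow]; simp
  generalize psiPoly 0 n (2 * z) (-1 / 3) = P
  field_simp
  linear_combination P * h1

theorem psiPoly_eq_hermiteH (κ x t s : ℂ) (n : ℕ) (ht : t ≠ 0) (hs : s ^ 2 = 3 * t) :
    psiPoly κ n x t = s ^ n * Complex.exp (-(n * Real.pi * Complex.I / 2)) *
      hermiteH n (Complex.I * (x + 2 * κ * t) / (2 * s)) := by
  have hs0 : s ≠ 0 := by
    rintro rfl
    simp [ht] at hs
  -- The scale c = i/s is chosen so that c²t = -t/(3t) = -1/3.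
  rw [hermiteH_eq_psiPoly, psiPoly_scale κ (Complex.I / s) n x t]
  · have he : Complex.exp (-(n * Real.pi * Complex.I / 2)) = (-Complex.I) ^ n := by
      rw [← Complex.exp_neg_pi_div_two_mul_I, ← Complex.exp_nat_mul]
      congr 1
      ring
    have h1 : s ^ n * (-Complex.I) ^ n * (Complex.I / s) ^ n = 1 := by
      rw [← mul_pow, ← mul_pow]
      have : s * -Complex.I * (Complex.I / s) = 1 := by
        field_simp
        simp
      rw [this, one_pow]
    rw [he]
    linear_combination -psiPoly κ n x t * h1
  · field_simp
  · rw [div_pow, hs, Complex.I_sq]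
    field_simp

end Hermite

/-! ### The three families of solutions. -/

section Solutions

variable {𝕜 : Type*} [NontriviallyNormedField 𝕜] [CharZero 𝕜]

theorem psiWeight_succ_left (𝕜 : Type*) [Field 𝕜] (a b : ℕ) :
    psiWeight 𝕜 (a + 1) b = psiWeight 𝕜 a b + (2 * a - b + 1) := by
  rw [psiWeight, psiWeight, Nat.add_right_comm, Finset.sum_range_succ, Finset.sum_range_succ]
  push_cast
  ring

theorem psiWeight_succ_right (𝕜 : Type*) [Field 𝕜] (a b : ℕ) :
    psiWeight 𝕜 a (b + 1) = psiWeight 𝕜 a b + (2 * b - a + 2) := by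
  rw [psiWeight, psiWeight, ← Nat.add_assoc, Finset.sum_range_succ, Finset.sum_range_succ]
  push_cast
  ring

variable {κ : 𝕜} {a b : ℕ} {D : Set (𝕜 × 𝕜)} {U L l : 𝕜 → 𝕜 → 𝕜}

/-- This and the next two lemmas read the same cycle (a, b) → (a + 1, b) → (a + 1, b + 1) → (a, b)
from its three starting points; c is the eigenvalue of the first step. -/
theorem isDWWSolutionOn_psiWronskian_left (hD : IsOpen D) {c : 𝕜} (hc : c = 2 * a - b + 1)
    (hL : IsSmoothLogOn D L (fun x t => psiWronskian κ (a + 1) b x t / psiWronskian κ a b x t))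
    (hl : IsSmoothLogOn D l (fun _ t => t))
    (hU : ∀ x t, U x t = L x t + x ^ 2 / (6 * t) - 1 / 3 * κ * (x + κ * t) - c * l x t) :
    IsDWWSolutionOn D U := by
  subst hc
  have h2 := isDarbouxPair_psiWronskian_right κ (a + 1) b
  refine isDWWSolutionOn_of_darboux_cycle (contDiff_psiWronskian κ a b)
    (contDiff_psiWronskian κ (a + 1) b) (contDiff_psiWronskian κ (a + 1) (b + 1))
    (isHomogeneousOfWeight_psiWronskian κ a b) ?_ (isDarbouxPair_psiWronskian_left κ a b)
    h2 (isDarbouxPair_psiWronskian_lower κ a b) ?_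
    (fun t => finite_setOf_psiWronskian_eq_zero κ t _ _) hD hL hl hU
  · rw [← psiWeight_succ_left]
    exact isHomogeneousOfWeight_psiWronskian κ (a + 1) b
  · push_cast; ring

theorem isDWWSolutionOn_psiWronskian_right (hD : IsOpen D) {c : 𝕜} (hc : c = 2 * b - a + 1)
    (hL : IsSmoothLogOn D L
      (fun x t => psiWronskian κ (a + 1) (b + 1) x t / psiWronskian κ (a + 1) b x t))
    (hl : IsSmoothLogOn D l (fun _ t => t))
    (hU : ∀ x t, U x t = L x t + x ^ 2 / (6 * t) - 1 / 3 * κ * (x + κ * t) - c * l x t) :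
    IsDWWSolutionOn D U := by
  have h2 := isDarbouxPair_psiWronskian_right κ (a + 1) b
  have hc' : 2 * b - ((a + 1 : ℕ) : 𝕜) + 2 = c := by rw [hc]; push_cast; ring
  rw [hc'] at h2
  refine isDWWSolutionOn_of_darboux_cycle (contDiff_psiWronskian κ (a + 1) b)
    (contDiff_psiWronskian κ (a + 1) (b + 1)) (contDiff_psiWronskian κ a b)
    (isHomogeneousOfWeight_psiWronskian κ (a + 1) b) ?_ h2
    (isDarbouxPair_psiWronskian_lower κ a b) (isDarbouxPair_psiWronskian_left κ a b) ?_
    (fun t => finite_setOf_psiWronskian_eq_zero κ t _ _) hD hL hl hU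
  · rw [← hc', ← psiWeight_succ_right]
    exact isHomogeneousOfWeight_psiWronskian κ (a + 1) (b + 1)
  · rw [hc]; ring

theorem isDWWSolutionOn_psiWronskian_lower (hD : IsOpen D) {c : 𝕜} (hc : c = -(a + b + 2))
    (hL : IsSmoothLogOn D L
      (fun x t => psiWronskian κ a b x t / psiWronskian κ (a + 1) (b + 1) x t))
    (hl : IsSmoothLogOn D l (fun _ t => t))
    (hU : ∀ x t, U x t = L x t + x ^ 2 / (6 * t) - 1 / 3 * κ * (x + κ * t) - c * l x t) :
    IsDWWSolutionOn D U := by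
  subst hc
  have h2 := isDarbouxPair_psiWronskian_right κ (a + 1) b
  refine isDWWSolutionOn_of_darboux_cycle (w := psiWeight 𝕜 (a + 1) (b + 1))
    (contDiff_psiWronskian κ (a + 1) (b + 1)) (contDiff_psiWronskian κ a b)
    (contDiff_psiWronskian κ (a + 1) b)
    (isHomogeneousOfWeight_psiWronskian κ (a + 1) (b + 1)) ?_
    (isDarbouxPair_psiWronskian_lower κ a b) (isDarbouxPair_psiWronskian_left κ a b) h2 ?_
    (fun t => finite_setOf_psiWronskian_eq_zero κ t _ _) hD hL hl hU
  · have : psiWeight 𝕜 (a + 1) (b + 1) + -(a + b + 2) = psiWeight 𝕜 a b := by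
      rw [psiWeight_succ_right, psiWeight_succ_left]; push_cast; ring
    rw [this]
    exact isHomogeneousOfWeight_psiWronskian κ a b
  · push_cast; ring

/-- The indices (m, n), (m + 1, n), (m, n + 1) are the three members of one cycle, in cyclic order.
For negative indices, in the next lemma, the same holds with the starting point rotated. -/
theorem exists_PsiPoly_of_pos {𝕜 : Type*} [NontriviallyNormedField 𝕜] (κ : 𝕜) {m n : ℤ}
    (h : 1 ≤ m ∧ 1 ≤ n) :
    ∃ a b : ℕ, (m : 𝕜) = a - b ∧ (n : 𝕜) = b + 1 ∧ PsiPoly κ m n = psiWronskian κ a b ∧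
      PsiPoly κ (m + 1) n = psiWronskian κ (a + 1) b ∧
      PsiPoly κ m (n + 1) = psiWronskian κ (a + 1) (b + 1) := by
  obtain ⟨b, hb⟩ := Int.eq_ofNat_of_zero_le (by omega : 0 ≤ n - 1)
  obtain ⟨a, ha⟩ := Int.eq_ofNat_of_zero_le (by omega : 0 ≤ m + n - 1)
  have hm : m = a - b := by omega
  have hn : n = b + 1 := by omega
  refine ⟨a, b, by rw [hm]; push_cast; ring, by rw [hn]; push_cast; ring, ?_, ?_, ?_⟩ <;>
  · funext x t
    rw [PsiPoly, if_pos (by omega)]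
    congr 1 <;> omega

theorem exists_PsiPoly_of_neg {𝕜 : Type*} [NontriviallyNormedField 𝕜] (κ : 𝕜) {m n : ℤ}
    (h : m ≤ -1 ∧ n ≤ -1) :
    ∃ a b : ℕ, (m : 𝕜) = -(a + 1) ∧ (n : 𝕜) = a - b ∧
      PsiPoly κ m n = psiWronskian κ (a + 1) (b + 1) ∧
      PsiPoly κ (m + 1) n = psiWronskian κ a b ∧
      PsiPoly κ m (n + 1) = psiWronskian κ (a + 1) b := by
  obtain ⟨a, ha⟩ := Int.eq_ofNat_of_zero_le (by omega : 0 ≤ -m - 1)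
  obtain ⟨b, hb⟩ := Int.eq_ofNat_of_zero_le (by omega : 0 ≤ -m - n - 1)
  have hm : m = -(a + 1) := by omega
  have hn : n = a - b := by omega
  refine ⟨a, b, by rw [hm]; push_cast; ring, by rw [hn]; push_cast; ring, ?_, ?_, ?_⟩ <;>
  · funext x t
    rw [PsiPoly, if_neg (by omega)]
    congr 1 <;> omega

/-- The three families of solutions, for given smooth logarithms. -/
theorem isDWWSolutionOn_PsiPoly (κ : 𝕜) {m n : ℤ} (h : (1 ≤ m ∧ 1 ≤ n) ∨ (m ≤ -1 ∧ n ≤ -1))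
    (hD : IsOpen D) (hl : IsSmoothLogOn D l (fun _ t => t)) :
    (IsSmoothLogOn D L (fun x t => PsiPoly κ (m + 1) n x t / PsiPoly κ m n x t) →
      IsDWWSolutionOn D (fun x t => L x t
        + x ^ 2 / (6 * t) - 1 / 3 * κ * (x + κ * t) - (2 * m + n) * l x t)) ∧
    (IsSmoothLogOn D L (fun x t => PsiPoly κ m n x t / PsiPoly κ m (n + 1) x t) →
      IsDWWSolutionOn D (fun x t => L x t
        + x ^ 2 / (6 * t) - 1 / 3 * κ * (x + κ * t) + (m + 2 * n) * l x t)) ∧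
    (IsSmoothLogOn D L (fun x t => PsiPoly κ m (n + 1) x t / PsiPoly κ (m + 1) n x t) →
      IsDWWSolutionOn D (fun x t => L x t
        + x ^ 2 / (6 * t) - 1 / 3 * κ * (x + κ * t) + (m - n) * l x t)) := by
  rcases h with h | h
  · obtain ⟨a, b, hm, hn, hA, hB, hC⟩ := exists_PsiPoly_of_pos κ h
    rw [hA, hB, hC, hm, hn]
    exact ⟨fun hL => isDWWSolutionOn_psiWronskian_left hD rfl hL hl fun x t => by ring,
      fun hL => isDWWSolutionOn_psiWronskian_lower hD rfl hL hl fun x t => by ring,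
      fun hL => isDWWSolutionOn_psiWronskian_right hD rfl hL hl fun x t => by ring⟩
  · obtain ⟨a, b, hm, hn, hC, hA, hB⟩ := exists_PsiPoly_of_neg κ h
    rw [hA, hB, hC, hm, hn]
    exact ⟨fun hL => isDWWSolutionOn_psiWronskian_lower hD rfl hL hl fun x t => by ring,
      fun hL => isDWWSolutionOn_psiWronskian_right hD rfl hL hl fun x t => by ring,
      fun hL => isDWWSolutionOn_psiWronskian_left hD rfl hL hl fun x t => by ring⟩

theorem contDiff_PsiPoly (κ : 𝕜) (m n : ℤ) :
    ContDiff 𝕜 ∞ (fun p : 𝕜 × 𝕜 => PsiPoly κ m n p.1 p.2) := by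
  unfold PsiPoly
  split_ifs
  exacts [contDiff_psiWronskian κ _ _, contDiff_psiWronskian κ _ _]

theorem finite_setOf_PsiPoly_eq_zero (κ t : 𝕜) (m n : ℤ) :
    {x : 𝕜 | PsiPoly κ m n x t = 0}.Finite := by
  unfold PsiPoly
  split_ifs
  exacts [finite_setOf_psiWronskian_eq_zero κ t _ _, finite_setOf_psiWronskian_eq_zero κ t _ _]

end Solutions

/-! ### Logarithms of the quotients of the Ψ on their domains. -/

section Domains

theorem isSmoothLogOn_real_log_div (κ : ℝ) (m n m' n' : ℤ) :
    IsOpen {p : ℝ × ℝ | p.2 ≠ 0 ∧ PsiPoly κ m n p.1 p.2 ≠ 0 ∧ PsiPoly κ m' n' p.1 p.2 ≠ 0} ∧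
    ∀ D ⊆ {p : ℝ × ℝ | p.2 ≠ 0 ∧ PsiPoly κ m n p.1 p.2 ≠ 0 ∧ PsiPoly κ m' n' p.1 p.2 ≠ 0},
      IsOpen D →
      IsSmoothLogOn D (fun _ t => Real.log t) (fun _ t => t) ∧
      IsSmoothLogOn D (fun x t => Real.log (PsiPoly κ m n x t / PsiPoly κ m' n' x t))
        (fun x t => PsiPoly κ m n x t / PsiPoly κ m' n' x t) := by
  refine ⟨?_, fun D hD ho => ⟨?_, ?_⟩⟩
  · exact (isOpen_ne_fun continuous_snd continuous_const).inter
      ((isOpen_ne_fun (contDiff_PsiPoly κ m n).continuous continuous_const).inter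
        (isOpen_ne_fun (contDiff_PsiPoly κ m' n').continuous continuous_const))
  · exact isSmoothLogOn_real_log ho contDiffOn_snd fun x t h => (hD h).1
  · exact isSmoothLogOn_real_log ho ((contDiff_PsiPoly κ m n).contDiffOn.div
      (contDiff_PsiPoly κ m' n').contDiffOn fun p hp => (hD hp).2.2)
      fun x t h => div_ne_zero (hD h).2.1 (hD h).2.2

theorem IsLogBranchOn.isSmoothLogOn_div {D : Set (ℂ × ℂ)} (hD : IsOpen D) {L : ℂ → ℂ → ℂ} {κ : ℂ}
    {m n m' n' : ℤ}
    (hL : IsLogBranchOn D L (fun x t => PsiPoly κ m n x t / PsiPoly κ m' n' x t)) :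
    IsSmoothLogOn D L (fun x t => PsiPoly κ m n x t / PsiPoly κ m' n' x t) := by
  refine hL.isSmoothLogOn hD ((contDiff_PsiPoly κ m n).contDiffOn.div
    (contDiff_PsiPoly κ m' n').contDiffOn fun p hp h0 => ?_)
  -- A zero of the denominator would make the quotient 0, which is not a value of the exponential.
  have := hL.2 p.1 p.2 hp
  beta_reduce at this
  rw [h0, div_zero] at this
  exact Complex.exp_ne_zero _ this

end Domains

theorem mainTheorem2 :
    -- the polynomials `ψ_n` in terms of Hermite polynomials; `s` is a square root of `3t`
    (∀ (κ x t s : ℂ) (n : ℕ), t ≠ 0 → s ^ 2 = 3 * t →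
      psiPoly κ n x t = s ^ n * Complex.exp (-(n * Real.pi * Complex.I / 2)) *
        hermiteH n (Complex.I * (x + 2 * κ * t) / (2 * s))) ∧
    -- no `Ψ_{m,n}` vanishes identically, not even for a fixed `t`
    (∀ (κ t : ℂ) (m n : ℤ), (1 ≤ m ∧ 1 ≤ n) ∨ (m ≤ 0 ∧ n ≤ 0) →
      {x : ℂ | PsiPoly κ m n x t = 0}.Finite) ∧
    -- the solutions of real variables, `Real.log y` being `ln |y|`
    (∀ (κ : ℝ) (m n : ℤ), (1 ≤ m ∧ 1 ≤ n) ∨ (m ≤ -1 ∧ n ≤ -1) →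
      IsDWWSolutionOn
        {p : ℝ × ℝ | p.2 ≠ 0 ∧ PsiPoly κ (m + 1) n p.1 p.2 ≠ 0 ∧ PsiPoly κ m n p.1 p.2 ≠ 0}
        (fun x t => Real.log (PsiPoly κ (m + 1) n x t / PsiPoly κ m n x t)
          + x ^ 2 / (6 * t) - 1 / 3 * κ * (x + κ * t) - (2 * m + n) * Real.log t) ∧
      IsDWWSolutionOn
        {p : ℝ × ℝ | p.2 ≠ 0 ∧ PsiPoly κ m n p.1 p.2 ≠ 0 ∧ PsiPoly κ m (n + 1) p.1 p.2 ≠ 0}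
        (fun x t => Real.log (PsiPoly κ m n x t / PsiPoly κ m (n + 1) x t)
          + x ^ 2 / (6 * t) - 1 / 3 * κ * (x + κ * t) + (m + 2 * n) * Real.log t) ∧
      IsDWWSolutionOn
        {p : ℝ × ℝ | p.2 ≠ 0 ∧ PsiPoly κ m (n + 1) p.1 p.2 ≠ 0 ∧
          PsiPoly κ (m + 1) n p.1 p.2 ≠ 0}
        (fun x t => Real.log (PsiPoly κ m (n + 1) x t / PsiPoly κ (m + 1) n x t)
          + x ^ 2 / (6 * t) - 1 / 3 * κ * (x + κ * t) + (m - n) * Real.log t)) ∧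
    -- the solutions of complex variables, for arbitrary branches of the logarithms
    (∀ (κ : ℂ) (m n : ℤ), (1 ≤ m ∧ 1 ≤ n) ∨ (m ≤ -1 ∧ n ≤ -1) →
      ∀ (D : Set (ℂ × ℂ)) (L ℓ : ℂ → ℂ → ℂ), IsOpen D → IsLogBranchOn D ℓ (fun _ t => t) →
      (IsLogBranchOn D L (fun x t => PsiPoly κ (m + 1) n x t / PsiPoly κ m n x t) →
        IsDWWSolutionOn D (fun x t => L x t
          + x ^ 2 / (6 * t) - 1 / 3 * κ * (x + κ * t) - (2 * m + n) * ℓ x t)) ∧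
      (IsLogBranchOn D L (fun x t => PsiPoly κ m n x t / PsiPoly κ m (n + 1) x t) →
        IsDWWSolutionOn D (fun x t => L x t
          + x ^ 2 / (6 * t) - 1 / 3 * κ * (x + κ * t) + (m + 2 * n) * ℓ x t)) ∧
      (IsLogBranchOn D L (fun x t => PsiPoly κ m (n + 1) x t / PsiPoly κ (m + 1) n x t) →
        IsDWWSolutionOn D (fun x t => L x t
          + x ^ 2 / (6 * t) - 1 / 3 * κ * (x + κ * t) + (m - n) * ℓ x t))) := by
  refine ⟨psiPoly_eq_hermiteH, fun κ t m n _ => finite_setOf_PsiPoly_eq_zero κ t m n,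
    fun κ m n h => ⟨?_, ?_, ?_⟩, fun κ m n h D L l hD hl => ?_⟩
  · obtain ⟨ho, hs⟩ := isSmoothLogOn_real_log_div κ (m + 1) n m n
    obtain ⟨hl, hL⟩ := hs _ subset_rfl ho
    exact (isDWWSolutionOn_PsiPoly κ h ho hl).1 hL
  · obtain ⟨ho, hs⟩ := isSmoothLogOn_real_log_div κ m n m (n + 1)
    obtain ⟨hl, hL⟩ := hs _ subset_rfl ho
    exact (isDWWSolutionOn_PsiPoly κ h ho hl).2.1 hL
  · obtain ⟨ho, hs⟩ := isSmoothLogOn_real_log_div κ m (n + 1) (m + 1) n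
    obtain ⟨hl, hL⟩ := hs _ subset_rfl ho
    exact (isDWWSolutionOn_PsiPoly κ h ho hl).2.2 hL
  · have hl' := hl.isSmoothLogOn hD contDiffOn_snd
    have hsol := isDWWSolutionOn_PsiPoly (L := L) κ h hD hl'
    exact ⟨fun hL => hsol.1 (hL.isSmoothLogOn_div hD),
      fun hL => hsol.2.1 (hL.isSmoothLogOn_div hD),
      fun hL => hsol.2.2 (hL.isSmoothLogOn_div hD)⟩
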